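/- **Conventions.** Let $d\ge 1$. $|E|$ is the Lebesgue measure of $E\subset\mathbb R^d$ and $\fint_E u=\frac1{|E|}\int_E u\,dx$. For a ball $B=B(x,r)$ and $s>0$, $sB=B(x,sr)$. For $1<q<\infty$, a nonnegative $\omega\in L^1_{\rm loc}(\mathbb R^d)$ is an $A_q$ weight if there is $C_\omega\ge 1$ with $$\fint_B\omega\cdot\Big(\fint_B\omega^{-\frac1{q-1}}\Big)^{q-1}\le C_\omega\quad\text{for every ball }B\subset\mathbb R^d;$$ the smallest such $C_\omega$ is the $A_q$ constant of $\omega$. **Theorem 2.1.** Let $0<p_0<p<p_1<\infty$, let $\omega$ be an $A_{p/p_0}$ weight in $\mathbb R^d$, let $B_0$ be a ball in $\mathbb R^d$, and let $F,f\in L^p(4B_0)$. Let $N_1,N_2>1$, $0<c_1<1$ and $\eta\ge 0$. Suppose that for each ball $B\subset 2B_0$ with $|B|\le c_1|B_0|$ and $100B\subset 4B_0$ (the last condition is automatic if $c_1\le 50^{-d}$) there exist two measurable functions $F_B$ and $R_B$ on $2B$ such that $|F|\le |F_B|+|R_B|$ a.e. on $2B$, $$\Big(\fint_{2B}|F_B|^{p_0}\Big)^{1/p_0}\le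 N_1\sup_{4B_0\supset B'\supset B}\Big(\fint_{B'}|f|^{p_0}\Big)^{1/p_0}+\eta\Big(\fint_{100B}|F|^{p_0}\Big)^{1/p_0},$$ and $$\Big(\fint_{2B}|R_B|^{p_1}\omega\,dx\Big)^{1/p_1}\le N_2\Big\{\Big(\fint_{100B}|F|^{p_0}\Big)^{1/p_0}+\sup_{4B_0\supset B'\supset B}\Big(\fint_{B'}|f|^{p_0}\Big)^{1/p_0}\Big\}\Big(\fint_B\omega\Big)^{1/p_1},$$ where the suprema are over balls $B'$ with $B\subset B'\subset 4B_0$. Then there exists $\eta_0>0$, depending only on $d,p_0,p_1,p,c_1,N_2$ and the $A_{p/p_0}$ constant of $\omega$, such that if $0\le\eta\le\eta_0$, then $$\Big(\fint_{B_0}|F|^p\omega\,dx\Big)^{1/p}\le C\Big(\fint_{4B_0}|f|^p\omega\,dx\Big)^{1/p}+C\Big(\fint_{4B_0}|F|^{p_0}\Big)^{1/p_0}\Big(\fint_{B_0}\omega\Big)^{1/p},$$ where $C$ depends only on $d,p_0,p_1,p,c_1,N_1,N_2$ and the $A_{p/p_0}$ constant of $\omega$. (Integrals take values in $[0,\infty]$;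 both $\eta_0$ and $C$ can be chosen uniformly over all weights whose $A_{p/p_0}$ constant is at most a given number.) -/

import Mathlib

open MeasureTheory Metric

open scoped ENNReal

/-- The `A_q` inequality (`1 < q < ∞`) with constant `C ≥ 1`: for every ball `B ⊂ ℝ^d`,
`⨍_B ω · (⨍_B ω^{-1/(q-1)})^{q-1} ≤ C`.
The averages are `[0,∞]`-valued, and `ω^{-1/(q-1)} = ∞` where `ω = 0`. -/
def ApBound {d : ℕ} (q : ℝ) (ω : EuclideanSpace ℝ (Fin d) → ℝ) (C : ℝ) : Prop :=
  1 ≤ C ∧ ∀ (x : EuclideanSpace ℝ (Fin d)) (r : ℝ), 0 < r →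
    (⨍⁻ y in ball x r, ENNReal.ofReal (ω y) ∂volume) *
      (⨍⁻ y in ball x r, ENNReal.ofReal (ω y) ^ (-(1 / (q - 1))) ∂volume) ^ (q - 1) ≤ ENNReal.ofReal C

/-- `ω ∈ A_q(ℝ^d)`, for `1 < q < ∞`. -/
structure IsApWeight {d : ℕ} (q : ℝ) (ω : EuclideanSpace ℝ (Fin d) → ℝ) : Prop where
  nonneg : ∀ x, 0 ≤ ω x
  locallyIntegrable : LocallyIntegrable ω volume
  bound : ∃ C : ℝ, ApBound q ω C

/-- The `A_q` constant of a weight: the smallest admissible constant. -/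
noncomputable def apConstant {d : ℕ} (q : ℝ) (ω : EuclideanSpace ℝ (Fin d) → ℝ) : ℝ :=
  sInf {C : ℝ | ApBound q ω C}

/-- `(⨍_E |g|^q)^{1/q}`, with respect to Lebesgue measure. -/
noncomputable def avgPow {d : ℕ} (q : ℝ) (g : EuclideanSpace ℝ (Fin d) → ℝ)
    (E : Set (EuclideanSpace ℝ (Fin d))) : ℝ≥0∞ :=
  (⨍⁻ x in E, ‖g x‖ₑ ^ q ∂volume) ^ (1 / q)

/-- `(⨍_E |g|^q ω dx)^{1/q}`; the average is taken with respect to Lebesgue measure. -/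
noncomputable def avgPowWeighted {d : ℕ} (q : ℝ) (ω g : EuclideanSpace ℝ (Fin d) → ℝ)
    (E : Set (EuclideanSpace ℝ (Fin d))) : ℝ≥0∞ :=
  (⨍⁻ x in E, ‖g x‖ₑ ^ q * ENNReal.ofReal (ω x) ∂volume) ^ (1 / q)

/-- `⨍_E ω`. -/
noncomputable def avgWeight {d : ℕ} (ω : EuclideanSpace ℝ (Fin d) → ℝ)
    (E : Set (EuclideanSpace ℝ (Fin d))) : ℝ≥0∞ :=
  ⨍⁻ x in E, ENNReal.ofReal (ω x) ∂volume

/-- `sup (⨍_{B'} |g|^q)^{1/q}`, over all balls `B'` with `B ⊂ B' ⊂ D`. (If `B` is nonempty,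
such `B'` have positive radius.) -/
noncomputable def supAvgPow {d : ℕ} (q : ℝ) (g : EuclideanSpace ℝ (Fin d) → ℝ)
    (B D : Set (EuclideanSpace ℝ (Fin d))) : ℝ≥0∞ :=
  ⨆ (z : EuclideanSpace ℝ (Fin d)) (s : ℝ) (_ : B ⊆ ball z s) (_ : ball z s ⊆ D),
    avgPow q g (ball z s)

/-! Put `q = p / p₀` and `s = p₁ / p₀`, let `g` and `h` be `|F|^p₀` and `|f|^p₀` cut off outside the
large ball, and write `M` for the uncentred maximal function over balls of radius at most `4 * r₀`.
The theorem becomes an `L^q(w)` bound for `g` on the ball of radius `r₀`, proved by a good-`λ`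
argument. For `t` above a multiple of the average of `g`, `good_lambda` bounds the weighted measure
of `{M g > a t}` in that ball by a constant times `(δ + θ)` times that of `{M g > t}`, plus a
constant times that of `{M h > γ t}`.

A stopping-time covering reduces this to single balls (`withDensity_inter_lt_maxFun_le`). There,
unless `M h > γ t`, `g` is at most `G + H`. The average of `G` is small, so by the weak type `(1,1)`
bound `M G` is large only on a set of small Lebesgue measure; the `A_∞` property
`exists_forall_withDensity_le` turns this into a small weighted fraction `δ`. The `L^s(w)` average
of `H` is bounded, so `IsMuckenhoupt.weak_type_rpow` gives a fraction `θ` of order `a ^ (-s)`.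

Integration against `t ^ (q - 1)` costs a factor `a ^ q`. As `q < s`, a large `a` makes `a ^ q * θ`
small; `δ` is then chosen, and with it the admissible average of `G`, hence `η₀`. Only afterwards is
`γ` chosen small against `N₁`, so `η₀` does not see `N₁`. The term with `M h` is controlled by
Muckenhoupt's theorem, `IsMuckenhoupt.lintegral_maxFun_rpow_le`, and `g ≤ M g` almost everywhere by
Lebesgue differentiation.

Neither weighted ingredient uses a reverse Hölder inequality: Muckenhoupt's theorem comes from a
pointwise bound by two iterated weighted maximal functions, and the `A_∞` property from repeatedly
enlarging a small set. -/

/-! ### Maximal functions for measures that are doubling on balls. -/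

section MaximalFunction

set_option linter.unusedSectionVars false

variable {X : Type*} [MetricSpace X] [MeasurableSpace X] [BorelSpace X]
  [SecondCountableTopology X]

/-- Balls of positive radius have positive finite measure, and enlarging a ball six times multiplies
its measure at most by the finite factor `D`. -/
structure DoublingOnBalls (μ : Measure X) (D : ℝ≥0∞) : Prop where
  const_ne_top : D ≠ ∞
  pos : ∀ (x : X) (r : ℝ), 0 < r → μ (ball x r) ≠ 0
  finite : ∀ (x : X) (r : ℝ), 0 < r → μ (ball x r) ≠ ∞
  enlarge : ∀ (x : X) (r : ℝ), 0 < r → μ (ball x (6 * r)) ≤ D * μ (ball x r)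

/-- The Vitali covering lemma for open balls of bounded radii. -/
theorem exists_disjoint_balls_covering {ι : Type*} (t : Set ι) (x : ι → X) (r : ι → ℝ) (R : ℝ)
    (hr : ∀ i ∈ t, r i ≤ R) (hr0 : ∀ i ∈ t, 0 < r i) :
    ∃ u ⊆ t, u.Countable ∧ u.PairwiseDisjoint (fun i => ball (x i) (r i)) ∧
      ⋃ i ∈ t, ball (x i) (r i) ⊆ ⋃ i ∈ u, ball (x i) (6 * r i) := by
  -- The enlargement factor 5 for closed balls becomes 6 to leave room for open balls.
  obtain ⟨u, hut, hd, hc⟩ :=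
    Vitali.exists_disjoint_subfamily_covering_enlargement_closedBall t x r R hr 5 (by norm_num)
  have hd' : u.PairwiseDisjoint (fun i => ball (x i) (r i)) :=
    hd.mono fun i => ball_subset_closedBall
  refine ⟨u, hut, hd'.countable_of_isOpen (fun i _ => isOpen_ball)
    (fun i hi => nonempty_ball.2 (hr0 i (hut hi))), hd', ?_⟩
  refine Set.iUnion₂_subset fun i hi => ?_
  obtain ⟨j, hj, hij⟩ := hc i hi
  refine (ball_subset_closedBall.trans (hij.trans ?_)).trans
    (Set.subset_biUnion_of_mem (u := fun i => ball (x i) (6 * r i)) hj)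
  exact closedBall_subset_ball (by linarith [hr0 j (hut hj)])

/-- The uncentred maximal function with respect to `μ`, over balls of radius at most `R`. -/
noncomputable def maxFun (μ : Measure X) (R : ℝ) (φ : X → ℝ≥0∞) (x : X) : ℝ≥0∞ :=
  ⨆ (z : X) (r : ℝ) (_ : 0 < r) (_ : r ≤ R) (_ : x ∈ ball z r),
    (∫⁻ y in ball z r, φ y ∂μ) / μ (ball z r)

theorem lt_maxFun_iff {μ : Measure X} {R : ℝ} {φ : X → ℝ≥0∞} {x : X} {t : ℝ≥0∞} :
    t < maxFun μ R φ x ↔ ∃ (z : X) (r : ℝ), 0 < r ∧ r ≤ R ∧ x ∈ ball z r ∧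
      t < (∫⁻ y in ball z r, φ y ∂μ) / μ (ball z r) := by
  simp only [maxFun, lt_iSup_iff, exists_prop]

theorem le_maxFun {μ : Measure X} {R : ℝ} (φ : X → ℝ≥0∞) {x z : X} {r : ℝ} (hr : 0 < r)
    (hrR : r ≤ R) (hx : x ∈ ball z r) :
    (∫⁻ y in ball z r, φ y ∂μ) / μ (ball z r) ≤ maxFun μ R φ x :=
  le_iSup_of_le z <| le_iSup_of_le r <| le_iSup_of_le hr <| le_iSup_of_le hrR <|
    le_iSup_of_le hx le_rfl

/-- A ball that witnesses a large average at one of its points does so at all of them, so no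
measurability of `φ` is needed. -/
theorem isOpen_lt_maxFun (μ : Measure X) (R : ℝ) (φ : X → ℝ≥0∞) (t : ℝ≥0∞) :
    IsOpen {x | t < maxFun μ R φ x} := by
  rw [isOpen_iff_mem_nhds]
  intro x hx
  obtain ⟨z, r, h0, hR, hxz, ht⟩ := lt_maxFun_iff.1 hx
  filter_upwards [isOpen_ball.mem_nhds hxz] with y hy
  exact lt_maxFun_iff.2 ⟨z, r, h0, hR, hy, ht⟩

theorem measurable_maxFun (μ : Measure X) (R : ℝ) (φ : X → ℝ≥0∞) : Measurable (maxFun μ R φ) :=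
  measurable_of_Ioi fun t => (isOpen_lt_maxFun μ R φ t).measurableSet

theorem DoublingOnBalls.lt_div_iff {μ : Measure X} {D : ℝ≥0∞} (hμ : DoublingOnBalls μ D)
    {x : X} {r : ℝ} (hr : 0 < r) {a b : ℝ≥0∞} :
    a < b / μ (ball x r) ↔ a * μ (ball x r) < b :=
  ENNReal.lt_div_iff_mul_lt (Or.inl (hμ.pos x r hr)) (Or.inl (hμ.finite x r hr))

/-- The weak type `(1,1)` inequality. -/
theorem DoublingOnBalls.weak_type {μ : Measure X} {D : ℝ≥0∞} (hμ : DoublingOnBalls μ D) (R : ℝ)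
    (φ : X → ℝ≥0∞) (t : ℝ≥0∞) :
    t * μ {x | t < maxFun μ R φ x} ≤ D * ∫⁻ x, φ x ∂μ := by
  let T : Set (X × ℝ) := {i | 0 < i.2 ∧ i.2 ≤ R ∧
    t * μ (ball i.1 i.2) < ∫⁻ y in ball i.1 i.2, φ y ∂μ}
  obtain ⟨u, hut, huc, hud, hcov⟩ := exists_disjoint_balls_covering T Prod.fst Prod.snd R
    (fun i hi => hi.2.1) (fun i hi => hi.1)
  have hsub : {x | t < maxFun μ R φ x} ⊆ ⋃ i ∈ u, ball i.1 (6 * i.2) := by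
    refine subset_trans (fun x hx => ?_) hcov
    obtain ⟨z, r, h0, hR, hxz, ht⟩ := lt_maxFun_iff.1 hx
    exact Set.mem_biUnion (x := ((z, r) : X × ℝ)) ⟨h0, hR, (hμ.lt_div_iff h0).1 ht⟩ hxz
  have := huc.to_subtype
  calc t * μ {x | t < maxFun μ R φ x}
      ≤ t * ∑' i : u, μ (ball i.1.1 (6 * i.1.2)) := by
        gcongr
        refine (measure_mono hsub).trans ?_
        rw [Set.biUnion_eq_iUnion]
        exact measure_iUnion_le _
    _ = ∑' i : u, t * μ (ball i.1.1 (6 * i.1.2)) := ENNReal.tsum_mul_left.symm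
    _ ≤ ∑' i : u, D * ∫⁻ y in ball i.1.1 i.1.2, φ y ∂μ := by
        refine ENNReal.tsum_le_tsum fun i => ?_
        have hi := hut i.2
        calc t * μ (ball i.1.1 (6 * i.1.2)) ≤ t * (D * μ (ball i.1.1 i.1.2)) := by
              gcongr; exact hμ.enlarge _ _ hi.1
          _ = D * (t * μ (ball i.1.1 i.1.2)) := by ring
          _ ≤ _ := by gcongr; exact hi.2.2.le
    _ = D * ∑' i : u, ∫⁻ y in ball i.1.1 i.1.2, φ y ∂μ := ENNReal.tsum_mul_left
    _ = D * ∫⁻ y in ⋃ i ∈ u, ball i.1 i.2, φ y ∂μ := by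
        rw [lintegral_biUnion huc (fun i _ => measurableSet_ball) hud]
    _ ≤ D * ∫⁻ x, φ x ∂μ := by gcongr D * ?_; exact setLIntegral_le_lintegral _ _

/-- The inner integral of the layer cake formula, at a fixed value `a` of the function. The value
`∞` is reached by letting finite bounds tend to infinity, so the layer cake formula needs no
finiteness. -/
theorem lintegral_Ioi_indicator_rpow {r : ℝ} (hr : 0 < r) (a : ℝ≥0∞) :
    ∫⁻ t in Set.Ioi (0 : ℝ), {t | ENNReal.ofReal t < a}.indicator
      (fun t => ENNReal.ofReal (t ^ (r - 1))) t = ENNReal.ofReal (1 / r) * a ^ r := by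
  have key : ∀ b : ℝ, 0 ≤ b → ∫⁻ t in Set.Ioo (0 : ℝ) b, ENNReal.ofReal (t ^ (r - 1)) =
      ENNReal.ofReal (1 / r) * ENNReal.ofReal b ^ r := by
    intro b hb
    rw [← ofReal_integral_eq_lintegral_ofReal]
    · rw [← integral_Ioc_eq_integral_Ioo, ← intervalIntegral.integral_of_le hb,
        integral_rpow (Or.inl (by linarith)), ENNReal.ofReal_rpow_of_nonneg hb hr.le,
        ← ENNReal.ofReal_mul (by positivity)]
      simp [Real.zero_rpow hr.ne']
      ring_nf
    · exact ((intervalIntegral.intervalIntegrable_rpow' (by linarith)).1).mono_set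
        Set.Ioo_subset_Ioc_self
    · filter_upwards [ae_restrict_mem measurableSet_Ioo] with t ht
      exact Real.rpow_nonneg ht.1.le _
  have hm : MeasurableSet {t : ℝ | ENNReal.ofReal t < a} :=
    measurableSet_lt ENNReal.measurable_ofReal measurable_const
  rw [setLIntegral_indicator hm]
  rcases eq_or_ne a ∞ with rfl | ha
  · rw [ENNReal.top_rpow_of_pos hr, ENNReal.mul_top (by simpa using hr)]
    have : ∀ n : ℕ, (ENNReal.ofReal (1 / r) * ENNReal.ofReal n ^ r) ≤
        ∫⁻ t in {t : ℝ | ENNReal.ofReal t < ∞} ∩ Set.Ioi 0, ENNReal.ofReal (t ^ (r - 1)) := by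
      intro n
      rw [← key n n.cast_nonneg]
      exact lintegral_mono_set fun t ht => ⟨ENNReal.ofReal_lt_top, ht.1⟩
    have htend : Filter.Tendsto (fun n : ℕ => ENNReal.ofReal (1 / r) * ENNReal.ofReal n ^ r)
        Filter.atTop (nhds (ENNReal.ofReal (1 / r) * ∞)) := by
      refine ENNReal.Tendsto.const_mul ?_ (Or.inl (by simp))
      have h1 : Filter.Tendsto (fun n : ℕ => ENNReal.ofReal n) Filter.atTop (nhds ∞) := by
        simpa using ENNReal.tendsto_nat_nhds_top
      simpa [Function.comp_def, ENNReal.top_rpow_of_pos hr] using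
        (ENNReal.continuous_rpow_const (y := r)).continuousAt.tendsto.comp h1
    rw [ENNReal.mul_top (by simpa using hr)] at htend
    exact top_le_iff.1 (le_of_tendsto' htend this)
  · lift a to NNReal using ha
    have : {t : ℝ | ENNReal.ofReal t < a} ∩ Set.Ioi 0 = Set.Ioo 0 (a : ℝ) := by
      ext t
      simp only [Set.mem_inter_iff, Set.mem_ofPred_eq, Set.mem_Ioi, Set.mem_Ioo]
      constructor
      · rintro ⟨h, h0⟩
        refine ⟨h0, ?_⟩
        rwa [← ENNReal.ofReal_coe_nnreal, ENNReal.ofReal_lt_ofReal_iff_of_nonneg h0.le] at h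
      · rintro ⟨h0, h⟩
        refine ⟨?_, h0⟩
        rwa [← ENNReal.ofReal_coe_nnreal, ENNReal.ofReal_lt_ofReal_iff_of_nonneg h0.le]
    rw [this, key a a.2, ENNReal.ofReal_coe_nnreal]

/-- The layer cake formula for a product of a density `ψ` and a power of `φ`. -/
theorem lintegral_mul_rpow_eq_layercake {μ : Measure X} [SFinite μ] {r : ℝ} (hr : 0 < r)
    {φ ψ : X → ℝ≥0∞} (hφ : Measurable φ) (hψ : Measurable ψ) :
    ∫⁻ t in Set.Ioi (0 : ℝ), ENNReal.ofReal (t ^ (r - 1)) *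
        ∫⁻ x in {x | ENNReal.ofReal t < φ x}, ψ x ∂μ =
      ENNReal.ofReal (1 / r) * ∫⁻ x, ψ x * φ x ^ r ∂μ := by
  have hm : MeasurableSet {z : ℝ × X | ENNReal.ofReal z.1 < φ z.2} :=
    measurableSet_lt (ENNReal.measurable_ofReal.comp measurable_fst) (hφ.comp measurable_snd)
  have hmt : ∀ t : ℝ, MeasurableSet {x : X | ENNReal.ofReal t < φ x} := fun t =>
    measurableSet_lt measurable_const hφ
  let f : ℝ → X → ℝ≥0∞ := fun t x => {z : ℝ × X | ENNReal.ofReal z.1 < φ z.2}.indicator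
    (fun z => ENNReal.ofReal (z.1 ^ (r - 1)) * ψ z.2) (t, x)
  have hf : Measurable (Function.uncurry f) := by
    refine Measurable.indicator ?_ hm
    exact (ENNReal.measurable_ofReal.comp (measurable_fst.pow_const _)).mul
      (hψ.comp measurable_snd)
  calc _ = ∫⁻ t in Set.Ioi (0 : ℝ), ∫⁻ x, f t x ∂μ := by
        refine lintegral_congr fun t => ?_
        rw [← lintegral_indicator (hmt t),
          ← lintegral_const_mul _ (hψ.indicator (hmt t))]
        refine lintegral_congr fun x => ?_
        by_cases h : ENNReal.ofReal t < φ x <;> simp [f, h]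
    _ = ∫⁻ x, (∫⁻ t in Set.Ioi (0 : ℝ), f t x) ∂μ := lintegral_lintegral_swap hf.aemeasurable
    _ = ∫⁻ x, ENNReal.ofReal (1 / r) * (ψ x * φ x ^ r) ∂μ := by
        refine lintegral_congr fun x => ?_
        rw [mul_left_comm, ← lintegral_Ioi_indicator_rpow hr (φ x), ← lintegral_const_mul]
        · refine lintegral_congr fun t => ?_
          by_cases h : ENNReal.ofReal t < φ x <;> simp [f, h, mul_comm]
        · refine Measurable.indicator ?_ (measurableSet_lt ENNReal.measurable_ofReal measurable_const)
          exact ENNReal.measurable_ofReal.comp (measurable_id.pow_const _)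
    _ = _ := lintegral_const_mul _ (hψ.mul (hφ.pow_const _))

theorem lintegral_rpow_eq_layercake {μ : Measure X} [SFinite μ] {r : ℝ} (hr : 0 < r)
    {φ : X → ℝ≥0∞} (hφ : Measurable φ) :
    ∫⁻ t in Set.Ioi (0 : ℝ), ENNReal.ofReal (t ^ (r - 1)) * μ {x | ENNReal.ofReal t < φ x} =
      ENNReal.ofReal (1 / r) * ∫⁻ x, φ x ^ r ∂μ := by
  simpa using lintegral_mul_rpow_eq_layercake (μ := μ) hr hφ (measurable_const (a := (1 : ℝ≥0∞)))

/-- The part of `φ` below height `t` contributes at most `t` to every average. This is the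
truncation step of Marcinkiewicz interpolation. -/
theorem maxFun_le_add {μ : Measure X} {D : ℝ≥0∞} (hμ : DoublingOnBalls μ D) {R : ℝ}
    {φ : X → ℝ≥0∞} (hφ : Measurable φ) (t : ℝ≥0∞) (x : X) :
    maxFun μ R φ x ≤ maxFun μ R ({x | t < φ x}.indicator φ) x + t := by
  refine iSup_le fun z => iSup_le fun r => iSup_le fun h0 => iSup_le fun hR => iSup_le fun hx => ?_
  have hb := hμ.pos z r h0
  have hb' := hμ.finite z r h0
  have hmt : MeasurableSet {x : X | t < φ x} := measurableSet_lt measurable_const hφ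
  calc (∫⁻ y in ball z r, φ y ∂μ) / μ (ball z r)
      ≤ (∫⁻ y in ball z r, ({x | t < φ x}.indicator φ y + t) ∂μ) / μ (ball z r) := by
        refine ENNReal.div_le_div_right (lintegral_mono fun y => ?_) _
        by_cases h : t < φ y
        · simp [h]
        · simp [h, not_lt.1 h]
    _ = (∫⁻ y in ball z r, {x | t < φ x}.indicator φ y ∂μ) / μ (ball z r) + t := by
        rw [lintegral_add_right _ measurable_const, ENNReal.add_div, setLIntegral_const,
          ENNReal.mul_div_cancel_right hb hb']
    _ ≤ _ := by gcongr; exact le_maxFun _ h0 hR hx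

/-- The strong type `(r,r)` inequality, `1 < r < ∞`. -/
theorem DoublingOnBalls.strong_type {μ : Measure X} [SFinite μ] {D : ℝ≥0∞}
    (hμ : DoublingOnBalls μ D) {r : ℝ} (hr : 1 < r) (R : ℝ) {φ : X → ℝ≥0∞} (hφ : Measurable φ) :
    ∫⁻ x, maxFun μ R φ x ^ r ∂μ ≤
      ENNReal.ofReal (r * 2 ^ r / (r - 1)) * D * ∫⁻ x, φ x ^ r ∂μ := by
  have h0 : 0 < r := by linarith
  have h1 : 0 < r - 1 := by linarith
  have hlc := lintegral_rpow_eq_layercake (μ := μ) h0 (measurable_maxFun μ R φ)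
  have hlc2 := lintegral_mul_rpow_eq_layercake (μ := μ) h1 (hφ.const_mul 2) hφ
  -- Marcinkiewicz interpolation: truncate at height `t / 2`, apply the weak type inequality to the
  -- upper part, and integrate in `t`; the lost factor `t` lowers the exponent on the right to `r -
  -- 1`, with `φ` as density.
  have hpt : ∀ t ∈ Set.Ioi (0 : ℝ), ENNReal.ofReal (t ^ (r - 1)) *
      μ {x | ENNReal.ofReal t < maxFun μ R φ x} ≤ 2 * D * (ENNReal.ofReal (t ^ (r - 1 - 1)) *
        ∫⁻ x in {x | ENNReal.ofReal t < 2 * φ x}, φ x ∂μ) := by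
    intro t (ht : 0 < t)
    have hset : {x | ENNReal.ofReal (t / 2) < φ x} = {x | ENNReal.ofReal t < 2 * φ x} := by
      ext x
      simp only [Set.mem_ofPred_eq]
      rw [ENNReal.ofReal_div_of_pos two_pos, ENNReal.div_lt_iff (by simp) (by simp),
        mul_comm (φ x)]
      simp
    have hw := hμ.weak_type R ({x | ENNReal.ofReal (t / 2) < φ x}.indicator φ)
      (ENNReal.ofReal (t / 2))
    rw [lintegral_indicator (measurableSet_lt measurable_const hφ), hset] at hw
    have hsub : {x | ENNReal.ofReal t < maxFun μ R φ x} ⊆ {x | ENNReal.ofReal (t / 2) <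
        maxFun μ R ({x | ENNReal.ofReal t < 2 * φ x}.indicator φ) x} := by
      intro x hx
      have h2 := maxFun_le_add hμ (R := R) hφ (ENNReal.ofReal (t / 2)) x
      rw [hset] at h2
      by_contra hcon
      simp only [Set.mem_ofPred_eq, not_lt] at hcon hx
      refine absurd (hx.trans_le (h2.trans (add_le_add_left hcon _))) ?_
      rw [← ENNReal.ofReal_add (by positivity) (by positivity), add_halves]
      exact lt_irrefl _
    have e1 : t ^ (r - 1) = 2 * t ^ (r - 1 - 1) * (t / 2) := by
      rw [Real.rpow_sub_one ht.ne' (r - 1)]; field_simp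
    calc _ ≤ ENNReal.ofReal (t ^ (r - 1)) * μ {x | ENNReal.ofReal (t / 2) <
        maxFun μ R ({x | ENNReal.ofReal t < 2 * φ x}.indicator φ) x} := by gcongr
      _ = 2 * ENNReal.ofReal (t ^ (r - 1 - 1)) * (ENNReal.ofReal (t / 2) *
          μ {x | ENNReal.ofReal (t / 2) <
            maxFun μ R ({x | ENNReal.ofReal t < 2 * φ x}.indicator φ) x}) := by
          rw [e1, ENNReal.ofReal_mul (by positivity), ENNReal.ofReal_mul (by positivity)]
          simp [mul_assoc]
      _ ≤ _ := by
          refine (mul_le_mul_right hw _).trans (le_of_eq ?_)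
          ring
  have hle : ENNReal.ofReal (1 / r) * ∫⁻ x, maxFun μ R φ x ^ r ∂μ ≤
      2 * D * (ENNReal.ofReal (1 / (r - 1)) * ∫⁻ x, φ x * (2 * φ x) ^ (r - 1) ∂μ) := by
    rw [← hlc, ← hlc2, ← lintegral_const_mul' _ _ (ENNReal.mul_ne_top (by simp) hμ.const_ne_top)]
    exact setLIntegral_mono' measurableSet_Ioi hpt
  have hpow : ∀ x, φ x * (2 * φ x) ^ (r - 1) = ENNReal.ofReal (2 ^ (r - 1)) * φ x ^ r := by
    intro x
    rw [ENNReal.mul_rpow_of_nonneg _ _ h1.le, mul_left_comm]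
    congr 1
    · rw [← ENNReal.ofReal_rpow_of_pos two_pos]; simp
    · nth_rewrite 1 [← ENNReal.rpow_one (φ x)]
      rw [← ENNReal.rpow_add_of_nonneg _ _ zero_le_one h1.le]; congr 1; ring
  simp_rw [hpow] at hle
  rw [lintegral_const_mul _ (hφ.pow_const _)] at hle
  calc ∫⁻ x, maxFun μ R φ x ^ r ∂μ
      = ENNReal.ofReal r * (ENNReal.ofReal (1 / r) * ∫⁻ x, maxFun μ R φ x ^ r ∂μ) := by
        rw [← mul_assoc, ← ENNReal.ofReal_mul h0.le, mul_one_div_cancel h0.ne']; simp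
    _ ≤ _ := mul_le_mul_right hle _
    _ = ENNReal.ofReal r * 2 * ENNReal.ofReal (1 / (r - 1)) * ENNReal.ofReal (2 ^ (r - 1)) * D *
        ∫⁻ x, φ x ^ r ∂μ := by ring
    _ = _ := by
        congr 2
        have : (2 : ℝ≥0∞) = ENNReal.ofReal 2 := by simp
        rw [this, ← ENNReal.ofReal_mul h0.le, ← ENNReal.ofReal_mul (by positivity),
          ← ENNReal.ofReal_mul (by positivity), Real.rpow_sub_one two_ne_zero]
        congr 1
        field_simp

end MaximalFunction

/-! ### Muckenhoupt weights and the weighted maximal theorem. -/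

section MuckenhouptWeights

variable {d : ℕ}

theorem rpow_ne_zero_of_nonneg {a : ℝ≥0∞} (ha : a ≠ 0) {y : ℝ} (hy : 0 ≤ y) : a ^ y ≠ 0 := by
  simp [ENNReal.rpow_eq_zero_iff, ha, hy.not_gt]

theorem setLIntegral_withDensity_eq {X : Type*} [MeasurableSpace X] {μ : Measure X}
    {w f : X → ℝ≥0∞} (hw : Measurable w) (hf : Measurable f) {s : Set X} (hs : MeasurableSet s) :
    ∫⁻ x in s, f x ∂(μ.withDensity w) = ∫⁻ x in s, f x * w x ∂μ := by
  rw [setLIntegral_withDensity_eq_setLIntegral_mul _ hw hf hs]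
  simp only [Pi.mul_apply, mul_comm]

theorem lintegral_withDensity_eq {X : Type*} [MeasurableSpace X] {μ : Measure X}
    {w f : X → ℝ≥0∞} (hw : Measurable w) (hf : Measurable f) :
    ∫⁻ x, f x ∂(μ.withDensity w) = ∫⁻ x, f x * w x ∂μ := by
  rw [lintegral_withDensity_eq_lintegral_mul _ hw hf]
  simp only [Pi.mul_apply, mul_comm]

theorem volume_ball_ne_zero (x : EuclideanSpace ℝ (Fin d)) {r : ℝ} (hr : 0 < r) :
    volume (ball x r) ≠ 0 := (measure_ball_pos volume x hr).ne'

theorem volume_ball_ne_top (x : EuclideanSpace ℝ (Fin d)) (r : ℝ) :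
    volume (ball x r) ≠ ∞ := measure_ball_lt_top.ne

theorem volume_ball_mul (x y : EuclideanSpace ℝ (Fin d)) {c : ℝ} (hc : 0 < c) (r : ℝ) :
    volume (ball x (c * r)) = ENNReal.ofReal (c ^ d) * volume (ball y r) := by
  rw [Measure.addHaar_ball_mul_of_pos volume x hc, Measure.addHaar_ball_center volume y r,
    finrank_euclideanSpace_fin]

theorem doublingOnBalls_volume :
    DoublingOnBalls (volume : Measure (EuclideanSpace ℝ (Fin d))) (ENNReal.ofReal (6 ^ d)) where
  const_ne_top := ENNReal.ofReal_ne_top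
  pos x r hr := volume_ball_ne_zero x hr
  finite x r _ := volume_ball_ne_top x r
  enlarge x r _ := (volume_ball_mul x x (by norm_num) r).le

/-- The dual weight `w ^ (-1 / (q - 1))`. -/
noncomputable def dualWeight (q : ℝ) (w : EuclideanSpace ℝ (Fin d) → ℝ≥0∞) :
    EuclideanSpace ℝ (Fin d) → ℝ≥0∞ := fun x => w x ^ (-(1 / (q - 1)))

/-- A measurable, everywhere positive and finite `A_q` weight with constant at most `A`. -/
structure IsMuckenhoupt (q : ℝ) (A : ℝ≥0∞) (w : EuclideanSpace ℝ (Fin d) → ℝ≥0∞) : Prop where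
  one_lt : 1 < q
  const_ne_top : A ≠ ∞
  measurable : Measurable w
  ne_zero : ∀ x, w x ≠ 0
  ne_top : ∀ x, w x ≠ ∞
  bound : ∀ (x : EuclideanSpace ℝ (Fin d)) (r : ℝ), 0 < r →
    (∫⁻ y in ball x r, w y) * (∫⁻ y in ball x r, dualWeight q w y) ^ (q - 1) ≤
      A * volume (ball x r) ^ q

theorem setLIntegral_ball_ne_zero {w : EuclideanSpace ℝ (Fin d) → ℝ≥0∞} (hw : Measurable w)
    (h0 : ∀ x, w x ≠ 0) (x : EuclideanSpace ℝ (Fin d)) {r : ℝ} (hr : 0 < r) :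
    ∫⁻ y in ball x r, w y ≠ 0 := by
  refine ((setLIntegral_pos_iff hw).2 ?_).ne'
  rw [show Function.support w = Set.univ from Set.eq_univ_of_forall h0, Set.univ_inter]
  exact measure_ball_pos volume x hr

namespace IsMuckenhoupt

variable {q : ℝ} {A : ℝ≥0∞} {w : EuclideanSpace ℝ (Fin d) → ℝ≥0∞}

theorem measurable_dualWeight (hw : IsMuckenhoupt q A w) : Measurable (dualWeight q w) :=
  hw.measurable.pow_const _

theorem dualWeight_ne_zero (hw : IsMuckenhoupt q A w) (x : EuclideanSpace ℝ (Fin d)) :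
    dualWeight q w x ≠ 0 := by
  simp [dualWeight, ENNReal.rpow_eq_zero_iff, hw.ne_zero x, hw.ne_top x]

theorem dualWeight_ne_top (hw : IsMuckenhoupt q A w) (x : EuclideanSpace ℝ (Fin d)) :
    dualWeight q w x ≠ ∞ := by
  simp [dualWeight, ENNReal.rpow_eq_top_iff, hw.ne_zero x, hw.ne_top x]

/-- The integral of the dual weight is positive, so infinite mass of `w` would make the left side of
the `A_q` inequality infinite. -/
theorem lintegral_ball_ne_top (hw : IsMuckenhoupt q A w) (x : EuclideanSpace ℝ (Fin d)) {r : ℝ}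
    (hr : 0 < r) : ∫⁻ y in ball x r, w y ≠ ∞ := by
  intro h
  have hb := hw.bound x r hr
  have hS := setLIntegral_ball_ne_zero hw.measurable_dualWeight hw.dualWeight_ne_zero x hr
  have hq : 0 < q - 1 := sub_pos.2 hw.one_lt
  rw [h, ENNReal.top_mul (rpow_ne_zero_of_nonneg hS hq.le), top_le_iff] at hb
  exact ENNReal.mul_ne_top hw.const_ne_top
    (ENNReal.rpow_ne_top_of_nonneg (by linarith) (volume_ball_ne_top x r)) hb

/-- Raising the `A_q` inequality to the power `1 / (q - 1)` exchanges the roles of `w` and its dual,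
because dualising twice returns `w`. -/
theorem dual (hw : IsMuckenhoupt q A w) :
    IsMuckenhoupt (q / (q - 1)) (A ^ (1 / (q - 1))) (dualWeight q w) := by
  have hq : 0 < q - 1 := sub_pos.2 hw.one_lt
  have hq' : q / (q - 1) - 1 = 1 / (q - 1) := by field_simp; ring
  have hdd : dualWeight (q / (q - 1)) (dualWeight q w) = w := by
    funext x
    simp only [dualWeight]
    rw [← ENNReal.rpow_mul, hq', one_div_one_div]
    have : -(1 / (q - 1)) * -(q - 1) = 1 := by field_simp
    rw [this, ENNReal.rpow_one]
  refine ⟨(one_lt_div hq).2 (by linarith),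
    ENNReal.rpow_ne_top_of_nonneg (by positivity) hw.const_ne_top, hw.measurable_dualWeight,
    hw.dualWeight_ne_zero, hw.dualWeight_ne_top, fun x r hr => ?_⟩
  have hb := ENNReal.rpow_le_rpow (hw.bound x r hr) (z := 1 / (q - 1)) (by positivity)
  rw [ENNReal.mul_rpow_of_nonneg _ _ (by positivity), ENNReal.mul_rpow_of_nonneg _ _ (by positivity),
    ← ENNReal.rpow_mul, ← ENNReal.rpow_mul, mul_one_div_cancel hq.ne', ENNReal.rpow_one,
    mul_one_div] at hb
  rwa [hdd, hq', mul_comm]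

/-- Jensen's inequality for averages against an `A_q` weight. -/
theorem lintegral_rpow_mul_le (hw : IsMuckenhoupt q A w) (x : EuclideanSpace ℝ (Fin d)) {r : ℝ}
    (hr : 0 < r) {φ : EuclideanSpace ℝ (Fin d) → ℝ≥0∞}
    (hφ : AEMeasurable φ (volume.restrict (ball x r))) :
    (∫⁻ y in ball x r, φ y) ^ q * ∫⁻ y in ball x r, w y ≤
      A * volume (ball x r) ^ q * ∫⁻ y in ball x r, φ y ^ q * w y := by
  have hq : 0 < q - 1 := sub_pos.2 hw.one_lt
  have hq0 : 0 < q := by linarith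
  have hc : q.HolderConjugate (q / (q - 1)) := Real.HolderConjugate.conjExponent hw.one_lt
  -- Hölder for `φ = (φ * w ^ (1 / q)) * w ^ (-(1 / q))`: the conjugate power of the second factor
  -- is the dual weight.
  have hH := ENNReal.lintegral_mul_le_Lp_mul_Lq (volume.restrict (ball x r)) hc
    (f := fun y => φ y * w y ^ (1 / q)) (g := fun y => w y ^ (-(1 / q)))
    (hφ.mul (hw.measurable.pow_const _).aemeasurable) (hw.measurable.pow_const _).aemeasurable
  have e1 : ∀ y, ((fun y => φ y * w y ^ (1 / q)) * fun y => w y ^ (-(1 / q))) y = φ y := by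
    intro y
    simp only [Pi.mul_apply]
    rw [mul_assoc, ← ENNReal.rpow_add _ _ (hw.ne_zero y) (hw.ne_top y), add_neg_cancel,
      ENNReal.rpow_zero, mul_one]
  have e2 : ∀ y, (φ y * w y ^ (1 / q)) ^ q = φ y ^ q * w y := by
    intro y
    rw [ENNReal.mul_rpow_of_nonneg _ _ hq0.le, ← ENNReal.rpow_mul, one_div_mul_cancel hq0.ne',
      ENNReal.rpow_one]
  have e3 : ∀ y, (w y ^ (-(1 / q))) ^ (q / (q - 1)) = dualWeight q w y := by
    intro y
    rw [← ENNReal.rpow_mul, dualWeight]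
    congr 1
    field_simp
  simp_rw [e1, e2, e3] at hH
  have hH' := ENNReal.rpow_le_rpow hH hq0.le
  rw [ENNReal.mul_rpow_of_nonneg _ _ hq0.le, ← ENNReal.rpow_mul, ← ENNReal.rpow_mul,
    one_div_mul_cancel hq0.ne', ENNReal.rpow_one,
    show 1 / (q / (q - 1)) * q = q - 1 by field_simp] at hH'
  calc _ ≤ ((∫⁻ y in ball x r, φ y ^ q * w y) * (∫⁻ y in ball x r, dualWeight q w y) ^ (q - 1)) *
        ∫⁻ y in ball x r, w y := by gcongr
    _ = (∫⁻ y in ball x r, φ y ^ q * w y) * ((∫⁻ y in ball x r, w y) *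
        (∫⁻ y in ball x r, dualWeight q w y) ^ (q - 1)) := by ring
    _ ≤ (∫⁻ y in ball x r, φ y ^ q * w y) * (A * volume (ball x r) ^ q) := by
        exact mul_le_mul_right (hw.bound x r hr) _
    _ = _ := by ring

/-- Measurable subsets of a ball of large Lebesgue density have large weighted density. -/
theorem volume_rpow_mul_le (hw : IsMuckenhoupt q A w) (x : EuclideanSpace ℝ (Fin d)) {r : ℝ}
    (hr : 0 < r) {E : Set (EuclideanSpace ℝ (Fin d))} (hE : MeasurableSet E) (hEB : E ⊆ ball x r) :
    volume E ^ q * volume.withDensity w (ball x r) ≤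
      A * volume (ball x r) ^ q * volume.withDensity w E := by
  have hq0 : 0 < q := by linarith [hw.one_lt]
  have h := hw.lintegral_rpow_mul_le x hr (φ := E.indicator 1)
    (measurable_one.indicator hE).aemeasurable
  have e : ∀ y, E.indicator (1 : EuclideanSpace ℝ (Fin d) → ℝ≥0∞) y ^ q * w y = E.indicator w y := by
    intro y
    by_cases hy : y ∈ E <;> simp [hy, hq0]
  simp_rw [e] at h
  rw [setLIntegral_indicator hE, setLIntegral_indicator hE, Set.inter_eq_left.2 hEB] at h
  simp only [Pi.one_apply, setLIntegral_one] at h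
  rwa [withDensity_apply _ measurableSet_ball, withDensity_apply _ hE]

/-- A ball fills a fixed fraction of its sixfold enlargement, so `volume_rpow_mul_le` compares their
weighted measures. -/
theorem doublingOnBalls (hw : IsMuckenhoupt q A w) :
    DoublingOnBalls (volume.withDensity w) (A * ENNReal.ofReal (6 ^ d) ^ q) where
  const_ne_top := ENNReal.mul_ne_top hw.const_ne_top
    (ENNReal.rpow_ne_top_of_nonneg (by linarith [hw.one_lt]) ENNReal.ofReal_ne_top)
  pos x r hr := by
    rw [withDensity_apply _ measurableSet_ball]
    exact setLIntegral_ball_ne_zero hw.measurable hw.ne_zero x hr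
  finite x r hr := by
    rw [withDensity_apply _ measurableSet_ball]
    exact hw.lintegral_ball_ne_top x hr
  enlarge x r hr := by
    have hq0 : 0 < q := by linarith [hw.one_lt]
    have h := hw.volume_rpow_mul_le x (r := 6 * r) (by linarith)
      (measurableSet_ball (x := x) (ε := r)) (ball_subset_ball (by linarith))
    rw [volume_ball_mul x x (by norm_num) r, ENNReal.mul_rpow_of_nonneg _ _ hq0.le] at h
    have h0 : volume (ball x r) ^ q ≠ 0 :=
      rpow_ne_zero_of_nonneg (volume_ball_ne_zero x hr) hq0.le
    have ht : volume (ball x r) ^ q ≠ ∞ :=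
      ENNReal.rpow_ne_top_of_nonneg hq0.le (volume_ball_ne_top x r)
    refine (ENNReal.mul_le_mul_iff_right h0 ht).1 (h.trans (le_of_eq ?_))
    ring

/-- With `σ` the dual weight, `σ ^ (1 - q) = w`; hence `φ ↦ φ / σ` is an isometry from `L^q(w)` to
`L^q(σ)`. -/
theorem div_dualWeight_rpow_mul (hw : IsMuckenhoupt q A w) (φ : EuclideanSpace ℝ (Fin d) → ℝ≥0∞)
    (x : EuclideanSpace ℝ (Fin d)) :
    (φ x / dualWeight q w x) ^ q * dualWeight q w x = φ x ^ q * w x := by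
  have hq : 0 < q - 1 := sub_pos.2 hw.one_lt
  have hq0 : 0 < q := by linarith
  rw [dualWeight, ENNReal.div_rpow_of_nonneg _ _ hq0.le, ← ENNReal.rpow_mul, div_eq_mul_inv,
    ← ENNReal.rpow_neg, mul_assoc, ← ENNReal.rpow_add _ _ (hw.ne_zero x) (hw.ne_top x)]
  congr 1
  have : -(-(1 / (q - 1)) * q) + -(1 / (q - 1)) = 1 := by field_simp; ring
  rw [this, ENNReal.rpow_one]

/-- Pointwise bound of the maximal function by iterated weighted maximal functions. -/
theorem maxFun_rpow_le (hw : IsMuckenhoupt q A w) (R : ℝ)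
    {h : EuclideanSpace ℝ (Fin d) → ℝ≥0∞} (hh : Measurable h) (x : EuclideanSpace ℝ (Fin d)) :
    maxFun volume R h x ^ (q - 1) ≤ A * maxFun (volume.withDensity w) R
      (fun y => maxFun (volume.withDensity (dualWeight q w)) R (fun z => h z / dualWeight q w z) y ^
        (q - 1) / w y) x := by
  have hq : 0 < q - 1 := sub_pos.2 hw.one_lt
  have hq0 : 0 < q := by linarith
  rw [← ENNReal.le_rpow_inv_iff hq]
  refine iSup_le fun z => iSup_le fun r => iSup_le fun h0 => iSup_le fun hR => iSup_le fun hx => ?_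
  rw [ENNReal.le_rpow_inv_iff hq]
  set σ := dualWeight q w with hσ
  set ψ := maxFun (volume.withDensity σ) R (fun z => h z / σ z) with hψ
  have hmσ : Measurable σ := hw.measurable_dualWeight
  have hmψ : Measurable ψ := measurable_maxFun _ _ _
  have hmhσ : Measurable fun z => h z / σ z := hh.div hmσ
  have hmψw : Measurable fun y => ψ y ^ (q - 1) / w y := (hmψ.pow_const _).div hw.measurable
  have hdσ := hw.dual.doublingOnBalls
  have hdw := hw.doublingOnBalls
  rw [← hσ] at hdσ
  set S := volume.withDensity σ (ball z r) with hS
  set W := volume.withDensity w (ball z r) with hW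
  set I := ∫⁻ y in ball z r, h y with hI
  set v := volume (ball z r) with hv
  have hS0 : S ≠ 0 := hdσ.pos z r h0
  have hSt : S ≠ ∞ := hdσ.finite z r h0
  have hW0 : W ≠ 0 := hdw.pos z r h0
  have hWt : W ≠ ∞ := hdw.finite z r h0
  have hv0 : v ≠ 0 := volume_ball_ne_zero z h0
  have hvt : v ≠ ∞ := volume_ball_ne_top z r
  have hIS : ∫⁻ y in ball z r, h y / σ y ∂(volume.withDensity σ) = I := by
    rw [setLIntegral_withDensity_eq hmσ hmhσ measurableSet_ball]
    refine lintegral_congr fun y => ?_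
    exact ENNReal.div_mul_cancel (hw.dualWeight_ne_zero y) (hw.dualWeight_ne_top y)
  -- `I / S` is the `σ`-average of `h / σ` over the ball, hence a lower bound for `ψ` at each of its
  -- points.
  have h1 : v * (I / S) ^ (q - 1) ≤ ∫⁻ y in ball z r, ψ y ^ (q - 1) := by
    rw [mul_comm, ← setLIntegral_const]
    refine setLIntegral_mono (hmψ.pow_const _) fun y hy => ?_
    refine ENNReal.rpow_le_rpow ?_ hq.le
    rw [← hIS]
    exact le_maxFun _ h0 hR hy
  have h2 : ∫⁻ y in ball z r, ψ y ^ (q - 1) =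
      ∫⁻ y in ball z r, ψ y ^ (q - 1) / w y ∂(volume.withDensity w) := by
    rw [setLIntegral_withDensity_eq hw.measurable hmψw measurableSet_ball]
    refine lintegral_congr fun y => ?_
    exact (ENNReal.div_mul_cancel (hw.ne_zero y) (hw.ne_top y)).symm
  have h3 : (∫⁻ y in ball z r, ψ y ^ (q - 1) / w y ∂(volume.withDensity w)) / W ≤
      maxFun (volume.withDensity w) R (fun y => ψ y ^ (q - 1) / w y) x := le_maxFun _ h0 hR hx
  have hb : W * S ^ (q - 1) ≤ A * v ^ q := by
    have := hw.bound z r h0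
    rwa [← withDensity_apply _ measurableSet_ball, ← withDensity_apply _ measurableSet_ball] at this
  have hvq : v ^ q = v * v ^ (q - 1) := by
    conv_rhs => rw [← ENNReal.rpow_one v]
    rw [← ENNReal.rpow_mul, one_mul, ← ENNReal.rpow_add _ _ hv0 hvt]; congr 1; ring
  have hvq0 : v ^ q ≠ 0 := rpow_ne_zero_of_nonneg hv0 hq0.le
  have hvqt : v ^ q ≠ ∞ := ENNReal.rpow_ne_top_of_nonneg hq0.le hvt
  refine le_trans ?_ (mul_le_mul_right h3 A)
  rw [← mul_div_assoc, ENNReal.le_div_iff_mul_le (Or.inl hW0) (Or.inl hWt), ← h2]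
  -- Both sides carry an extra `v ^ q`, so that the `A_q` inequality in the form `W * S ^ (q - 1) ≤
  -- A * v ^ q` enters by multiplication.
  have key : (I / v) ^ (q - 1) * W * v ^ q ≤ A * (v * (I / S) ^ (q - 1)) * v ^ q := by
    calc (I / v) ^ (q - 1) * W * v ^ q
        = ((I / v) * v) ^ (q - 1) * W * v := by
          rw [ENNReal.mul_rpow_of_nonneg _ _ hq.le, hvq]; ring
      _ = ((I / S) * S) ^ (q - 1) * W * v := by
          rw [ENNReal.div_mul_cancel hv0 hvt, ENNReal.div_mul_cancel hS0 hSt]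
      _ = (I / S) ^ (q - 1) * v * (W * S ^ (q - 1)) := by
          rw [ENNReal.mul_rpow_of_nonneg _ _ hq.le]; ring
      _ ≤ (I / S) ^ (q - 1) * v * (A * v ^ q) := by gcongr
      _ = _ := by ring
  exact ((ENNReal.mul_le_mul_iff_left hvq0 hvqt).1 key).trans (by gcongr)

/-- The constant in Muckenhoupt's theorem. -/
noncomputable def maxConst (d : ℕ) (q : ℝ) (A : ℝ≥0∞) : ℝ≥0∞ :=
  A ^ (q / (q - 1)) *
    (ENNReal.ofReal (q / (q - 1) * 2 ^ (q / (q - 1)) / (q / (q - 1) - 1)) *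
      (A * ENNReal.ofReal (6 ^ d) ^ q)) *
    (ENNReal.ofReal (q * 2 ^ q / (q - 1)) *
      (A ^ (1 / (q - 1)) * ENNReal.ofReal (6 ^ d) ^ (q / (q - 1))))

theorem maxConst_ne_top (hq : 1 < q) (hA : A ≠ ∞) : maxConst d q A ≠ ∞ := by
  have h1 : 0 < q - 1 := sub_pos.2 hq
  have h2 : 0 ≤ q / (q - 1) := by positivity
  unfold maxConst
  refine ENNReal.mul_ne_top (ENNReal.mul_ne_top ?_ (ENNReal.mul_ne_top ENNReal.ofReal_ne_top
    (ENNReal.mul_ne_top hA ?_))) (ENNReal.mul_ne_top ENNReal.ofReal_ne_top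
    (ENNReal.mul_ne_top ?_ ?_))
  · exact ENNReal.rpow_ne_top_of_nonneg h2 hA
  · exact ENNReal.rpow_ne_top_of_nonneg (by linarith) ENNReal.ofReal_ne_top
  · exact ENNReal.rpow_ne_top_of_nonneg (by positivity) hA
  · exact ENNReal.rpow_ne_top_of_nonneg h2 ENNReal.ofReal_ne_top

/-- **Muckenhoupt's theorem**: the maximal function is bounded on `L^q(w)`, with a bound depending
only on `d`, `q` and the `A_q` constant. -/
theorem lintegral_maxFun_rpow_le (hw : IsMuckenhoupt q A w) (R : ℝ)
    {h : EuclideanSpace ℝ (Fin d) → ℝ≥0∞} (hh : Measurable h) :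
    ∫⁻ x, maxFun volume R h x ^ q ∂(volume.withDensity w) ≤
      maxConst d q A * ∫⁻ x, h x ^ q ∂(volume.withDensity w) := by
  have hq : 0 < q - 1 := sub_pos.2 hw.one_lt
  have hq0 : 0 < q := by linarith
  set q' := q / (q - 1) with hq'
  have hq'0 : 0 < q' := by positivity
  have hqq : (q - 1) * q' = q := by rw [hq']; field_simp
  set σ := dualWeight q w with hσ
  set ψ := maxFun (volume.withDensity σ) R (fun z => h z / σ z) with hψ
  have hmσ : Measurable σ := hw.measurable_dualWeight
  have hmψ : Measurable ψ := measurable_maxFun _ _ _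
  have hmhσ : Measurable fun z => h z / σ z := hh.div hmσ
  have hmψw : Measurable fun y => ψ y ^ (q - 1) / w y := (hmψ.pow_const _).div hw.measurable
  set Ψ := maxFun (volume.withDensity w) R (fun y => ψ y ^ (q - 1) / w y) with hΨ
  have hmΨ : Measurable Ψ := measurable_maxFun _ _ _
  have hpt : ∀ x, maxFun volume R h x ^ q ≤ A ^ q' * Ψ x ^ q' := by
    intro x
    have := ENNReal.rpow_le_rpow (hw.maxFun_rpow_le R hh x) hq'0.le
    rwa [← ENNReal.rpow_mul, hqq, ENNReal.mul_rpow_of_nonneg _ _ hq'0.le] at this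
  -- The outer maximal function acts on `L^{q'}(w)` and the inner one on `L^q(σ)`. Each is taken
  -- with respect to its own doubling measure, so every exponent above 1 is allowed and `q` need not
  -- be improved.
  have hs1 := hw.doublingOnBalls.strong_type hw.dual.one_lt R hmψw
  have hs2 := hw.dual.doublingOnBalls.strong_type hw.one_lt R hmhσ
  have e1 : ∫⁻ y, (ψ y ^ (q - 1) / w y) ^ q' ∂(volume.withDensity w) =
      ∫⁻ y, ψ y ^ q ∂(volume.withDensity σ) := by
    rw [lintegral_withDensity_eq hw.measurable (hmψw.pow_const _),
      lintegral_withDensity_eq hmσ (hmψ.pow_const _)]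
    refine lintegral_congr fun y => ?_
    rw [ENNReal.div_rpow_of_nonneg _ _ hq'0.le, ← ENNReal.rpow_mul, hqq, div_eq_mul_inv,
      ← ENNReal.rpow_neg, mul_assoc]
    nth_rewrite 2 [← ENNReal.rpow_one (w y)]
    rw [← ENNReal.rpow_add _ _ (hw.ne_zero y) (hw.ne_top y), hσ, dualWeight]
    congr 2
    rw [hq']; field_simp; ring
  have e2 : ∫⁻ x, (h x / σ x) ^ q ∂(volume.withDensity σ) =
      ∫⁻ x, h x ^ q ∂(volume.withDensity w) := by
    rw [lintegral_withDensity_eq hmσ (hmhσ.pow_const _),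
      lintegral_withDensity_eq hw.measurable (hh.pow_const _)]
    exact lintegral_congr fun y => hw.div_dualWeight_rpow_mul h y
  calc ∫⁻ x, maxFun volume R h x ^ q ∂(volume.withDensity w)
      ≤ ∫⁻ x, A ^ q' * Ψ x ^ q' ∂(volume.withDensity w) := lintegral_mono hpt
    _ = A ^ q' * ∫⁻ x, Ψ x ^ q' ∂(volume.withDensity w) :=
        lintegral_const_mul _ (hmΨ.pow_const _)
    _ ≤ A ^ q' * (_ * ∫⁻ y, ψ y ^ q ∂(volume.withDensity σ)) := by
        rw [← e1]; exact mul_le_mul_right hs1 _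
    _ ≤ A ^ q' * (_ * (_ * ∫⁻ x, h x ^ q ∂(volume.withDensity w))) := by
        rw [← e2]; exact mul_le_mul_right (mul_le_mul_right hs2 _) _
    _ = _ := by
        rw [maxConst, ← hq']; ring

end IsMuckenhoupt

end MuckenhouptWeights

/-! ### The `A_∞` property, by expansion of small sets. -/

section SmallSets

variable {d : ℕ}

/-- One-sided form of the Lebesgue differentiation theorem on open balls. -/
theorem ae_exists_ball_lt_setLIntegral {φ : EuclideanSpace ℝ (Fin d) → ℝ≥0∞} (hφ : Measurable φ)
    (hfin : ∫⁻ x, φ x ≠ ∞) :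
    ∀ᵐ x, ∀ t < φ x, ∀ R : ℝ, 0 < R → ∃ r, 0 < r ∧ r ≤ R ∧
      t * volume (ball x r) < ∫⁻ y in ball x r, φ y := by
  filter_upwards [(Besicovitch.vitaliFamily
    (volume : Measure (EuclideanSpace ℝ (Fin d)))).ae_tendsto_lintegral_div hφ.aemeasurable hfin]
    with x hx t ht R hR
  have h1 := hx.comp (Besicovitch.tendsto_filterAt volume x)
  have h2 := h1.eventually (lt_mem_nhds ht)
  obtain ⟨r, hr, hrR⟩ := (h2.and (Ioc_mem_nhdsGT hR)).exists
  refine ⟨r, hrR.1, hrR.2, ?_⟩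
  have hv : volume (closedBall x r) = volume (ball x r) := by
    rw [Measure.addHaar_closedBall volume x hrR.1.le, Measure.addHaar_ball_of_pos volume x hrR.1]
  have hae : (ball x r : Set (EuclideanSpace ℝ (Fin d))) =ᵐ[volume] closedBall x r :=
    ae_eq_of_subset_of_measure_ge ball_subset_closedBall hv.le
      measurableSet_ball.nullMeasurableSet (hv ▸ volume_ball_ne_top x r)
  simp only [Function.comp_apply, hv] at hr
  rw [← setLIntegral_congr hae] at hr
  exact (doublingOnBalls_volume.lt_div_iff hrR.1).1 hr

/-- A stopping radius. The supremum need not be attained, so an element above half of it is taken;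
this is the source of the factor 2. -/
theorem exists_mem_forall_two_mul_le_notMem {S : Set ℝ} (hne : S.Nonempty) (hpos : ∀ r ∈ S, 0 < r)
    (hbdd : BddAbove S) : ∃ r ∈ S, ∀ r', 2 * r ≤ r' → r' ∉ S := by
  obtain ⟨a, ha⟩ := hne
  have hs : 0 < sSup S := (hpos a ha).trans_le (le_csSup hbdd ha)
  obtain ⟨r, hr, hlt⟩ := exists_lt_of_lt_csSup ⟨a, ha⟩ (half_lt_self hs)
  exact ⟨r, hr, fun r' h hr' => by linarith [le_csSup hbdd hr']⟩

namespace IsMuckenhoupt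

/-- Factor controlling the weighted measure of a small set by that of its expansion. -/
noncomputable def growthConst (d : ℕ) (q : ℝ) (A : ℝ≥0∞) : ℝ≥0∞ :=
  1 + A * ENNReal.ofReal (6 ^ d) ^ q * (2 ^ q * A)

variable {q : ℝ} {A : ℝ≥0∞} {w : EuclideanSpace ℝ (Fin d) → ℝ≥0∞}

theorem growthConst_ne_top (hw : IsMuckenhoupt q A w) : growthConst d q A ≠ ∞ :=
  ENNReal.add_ne_top.2 ⟨ENNReal.one_ne_top, ENNReal.mul_ne_top hw.doublingOnBalls.const_ne_top
    (ENNReal.mul_ne_top (ENNReal.rpow_ne_top_of_nonneg (by linarith [hw.one_lt]) (by simp))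
      hw.const_ne_top)⟩

/-- The complement of `E` fills at least half of the ball, so `volume_rpow_mul_le` applies to it. -/
theorem withDensity_ball_le_diff (hw : IsMuckenhoupt q A w) (x : EuclideanSpace ℝ (Fin d)) {r : ℝ}
    (hr : 0 < r) {E : Set (EuclideanSpace ℝ (Fin d))} (hE : MeasurableSet E)
    (h : 2 * volume (E ∩ ball x r) ≤ volume (ball x r)) :
    volume.withDensity w (ball x r) ≤ 2 ^ q * A * volume.withDensity w (ball x r \ E) := by
  have hq0 : 0 ≤ q := by linarith [hw.one_lt]
  set v := volume (ball x r) with hv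
  have hv0 : v ≠ 0 := volume_ball_ne_zero x hr
  have hvt : v ≠ ∞ := volume_ball_ne_top x r
  have hsplit : volume (E ∩ ball x r) + volume (ball x r \ E) = v := by
    rw [Set.inter_comm]; exact measure_inter_add_sdiff _ hE
  have h2 : v ≤ 2 * volume (ball x r \ E) := by
    have h3 : v + v ≤ v + 2 * volume (ball x r \ E) := by
      calc v + v = 2 * volume (E ∩ ball x r) + 2 * volume (ball x r \ E) := by
            rw [← mul_add, hsplit, two_mul]
        _ ≤ _ := by gcongr
    exact (ENNReal.add_le_add_iff_left hvt).1 h3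
  have h4 := hw.volume_rpow_mul_le x hr (measurableSet_ball.diff hE) Set.sdiff_subset
  have hvq0 : v ^ q ≠ 0 := rpow_ne_zero_of_nonneg hv0 hq0
  have hvqt : v ^ q ≠ ∞ := ENNReal.rpow_ne_top_of_nonneg hq0 hvt
  refine (ENNReal.mul_le_mul_iff_right hvq0 hvqt).1 ?_
  calc v ^ q * volume.withDensity w (ball x r)
      ≤ (2 * volume (ball x r \ E)) ^ q * volume.withDensity w (ball x r) := by gcongr
    _ = 2 ^ q * (volume (ball x r \ E) ^ q * volume.withDensity w (ball x r)) := by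
        rw [ENNReal.mul_rpow_of_nonneg _ _ hq0, mul_assoc]
    _ ≤ 2 ^ q * (A * v ^ q * volume.withDensity w (ball x r \ E)) := by gcongr
    _ = _ := by ring

/-- A set of small Lebesgue measure has an expansion of comparable Lebesgue measure, inside a
neighbourhood, whose weighted measure is larger by a definite factor. -/
theorem exists_expansion (hw : IsMuckenhoupt q A w) {x : EuclideanSpace ℝ (Fin d)} {R τ : ℝ}
    (hτ : 0 < τ) {E : Set (EuclideanSpace ℝ (Fin d))} (hE : MeasurableSet E)
    (hER : E ⊆ ball x R) (hτE : 2 * volume E ≤ volume (ball x τ)) :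
    ∃ E' : Set (EuclideanSpace ℝ (Fin d)), MeasurableSet E' ∧ E' ⊆ ball x (R + 2 * τ) ∧
      volume E' ≤ (1 + ENNReal.ofReal (2 ^ d) * 2) * volume E ∧
      (1 + (growthConst d q A)⁻¹) * volume.withDensity w E ≤ volume.withDensity w E' := by
  set μ := volume.withDensity w with hμ
  have hEfin : volume E ≠ ∞ := measure_ne_top_of_subset hER (volume_ball_ne_top x R)
  -- The radii at which `E` fills more than half of the ball; the smallness of `E` keeps them below
  -- `τ`, and at almost every point of `E` there is one.
  let S : EuclideanSpace ℝ (Fin d) → Set ℝ := fun y =>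
    {r | 0 < r ∧ volume (ball y r) < 2 * volume (E ∩ ball y r)}
  have hSτ : ∀ y, ∀ r ∈ S y, r < τ := by
    rintro y r ⟨hr, hlt⟩
    by_contra! hcon
    refine absurd (hlt.trans_le ((mul_le_mul_right (measure_mono Set.inter_subset_left) 2).trans
      hτE)) (not_lt.2 ?_)
    rw [Measure.addHaar_ball_center volume x, ← Measure.addHaar_ball_center volume y]
    exact measure_mono (ball_subset_ball hcon)
  have hexit : ∀ y, (S y).Nonempty → ∃ r ∈ S y, ∀ r', 2 * r ≤ r' → r' ∉ S y := fun y hy =>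
    exists_mem_forall_two_mul_le_notMem hy (fun r hr => hr.1) ⟨τ, fun r hr => (hSτ y r hr).le⟩
  -- At radius `ρ y` the set `E` is still dense, which bounds the volume added. At radius `2 * ρ y`
  -- it fills at most half, which makes the weighted mass added substantial.
  choose! ρ hρS hρ using hexit
  let T : Set (EuclideanSpace ℝ (Fin d)) := {y | y ∈ E ∧ (S y).Nonempty}
  have hae : μ (E \ T) = 0 := by
    refine withDensity_absolutelyContinuous volume w ?_
    have hLD := ae_exists_ball_lt_setLIntegral (φ := E.indicator 1) (measurable_one.indicator hE)
      (by rwa [lintegral_indicator_one hE])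
    refine measure_mono_null ?_ hLD
    rintro y ⟨hyE, hyT⟩ hy
    obtain ⟨r, hr, -, hlt⟩ := hy 2⁻¹ (by simp [hyE]) 1 one_pos
    refine hyT ⟨hyE, r, hr, ?_⟩
    rw [setLIntegral_indicator hE] at hlt
    simp only [Pi.one_apply, setLIntegral_one] at hlt
    rw [mul_comm, ← div_eq_mul_inv] at hlt
    rw [mul_comm]
    exact (ENNReal.div_lt_iff (by simp) (by simp)).1 hlt
  obtain ⟨u, huT, huc, hud, hcov⟩ := exists_disjoint_balls_covering T id (fun y => 2 * ρ y) (2 * τ)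
    (fun y hy => by linarith [hSτ y _ (hρS y hy.2)]) (fun y hy => by linarith [(hρS y hy.2).1])
  simp only [id] at hud hcov
  have := huc.to_subtype
  have hρ0 : ∀ y ∈ u, 0 < 2 * ρ y := fun y hy => by linarith [(hρS y (huT hy).2).1]
  have hU : MeasurableSet (⋃ y ∈ u, ball y (2 * ρ y)) :=
    MeasurableSet.biUnion huc fun y _ => measurableSet_ball
  refine ⟨E ∪ ⋃ y ∈ u, ball y (2 * ρ y), hE.union hU, ?_, ?_, ?_⟩
  · refine Set.union_subset (fun y hy => ?_) (Set.iUnion₂_subset fun y hy => ?_)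
    · exact ball_subset_ball (by linarith) (hER hy)
    · have h1 := hER (huT hy).1
      have h2 := hSτ y _ (hρS y (huT hy).2)
      refine ball_subset_ball' ?_
      rw [mem_ball] at h1
      linarith
  · have hdis : u.PairwiseDisjoint fun y => E ∩ ball y (ρ y) :=
      hud.mono_on fun y hy => Set.inter_subset_right.trans
        (ball_subset_ball (by linarith [hρ0 y hy]))
    rw [add_mul, one_mul]
    refine (measure_union_le _ _).trans (add_le_add_right ?_ _)
    calc volume (⋃ y ∈ u, ball y (2 * ρ y))
        ≤ ∑' y : u, volume (ball y.1 (2 * ρ y)) := by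
          rw [Set.biUnion_eq_iUnion]; exact measure_iUnion_le _
      _ ≤ ∑' y : u, ENNReal.ofReal (2 ^ d) * 2 * volume (E ∩ ball y.1 (ρ y)) := by
          refine ENNReal.tsum_le_tsum fun y => ?_
          rw [volume_ball_mul y.1 y.1 two_pos, mul_assoc]
          gcongr
          exact (hρS y (huT y.2).2).2.le
      _ = ENNReal.ofReal (2 ^ d) * 2 * volume (⋃ y ∈ u, E ∩ ball y (ρ y)) := by
          rw [ENNReal.tsum_mul_left,
            measure_biUnion huc hdis fun y _ => hE.inter measurableSet_ball]
      _ ≤ _ := by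
          gcongr
          exact Set.iUnion₂_subset fun y _ => Set.inter_subset_left
  · set L := growthConst d q A with hL
    have hL0 : L ≠ 0 := by simp [hL, growthConst]
    have hLt : L ≠ ∞ := hw.growthConst_ne_top
    have hEU : E ∪ ⋃ y ∈ u, ball y (2 * ρ y) = E ∪ ((⋃ y ∈ u, ball y (2 * ρ y)) \ E) := by simp
    rw [hEU, measure_union Set.disjoint_sdiff_right (hU.diff hE), add_mul, one_mul]
    gcongr
    rw [ENNReal.inv_mul_le_iff hL0 hLt]
    -- Almost all of `E` lies in the sixfold enlargements; by doubling their mass is controlled by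
    -- the disjoint balls, and then by the parts of these outside `E`.
    have hTcov : T ⊆ ⋃ y ∈ u, ball y (6 * (2 * ρ y)) := fun y hy =>
      hcov (Set.mem_biUnion hy (mem_ball_self (by linarith [(hρS y hy.2).1])))
    calc μ E ≤ μ (T ∪ E \ T) := measure_mono fun y hy => by
            by_cases h : y ∈ T
            · exact Or.inl h
            · exact Or.inr ⟨hy, h⟩
      _ ≤ μ T + μ (E \ T) := measure_union_le _ _
      _ ≤ ∑' y : u, μ (ball y.1 (6 * (2 * ρ y))) := by
          rw [hae, add_zero]
          refine (measure_mono hTcov).trans ?_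
          rw [Set.biUnion_eq_iUnion]; exact measure_iUnion_le _
      _ ≤ ∑' y : u, A * ENNReal.ofReal (6 ^ d) ^ q * (2 ^ q * A) * μ (ball y.1 (2 * ρ y) \ E) := by
          refine ENNReal.tsum_le_tsum fun y => ?_
          refine (hw.doublingOnBalls.enlarge _ _ (hρ0 y y.2)).trans ?_
          rw [mul_assoc _ (2 ^ q * A)]
          gcongr
          refine hw.withDensity_ball_le_diff _ (hρ0 y y.2) hE ?_
          by_contra! hcon
          exact hρ y (huT y.2).2 _ le_rfl ⟨hρ0 y y.2, hcon⟩
      _ = A * ENNReal.ofReal (6 ^ d) ^ q * (2 ^ q * A) * μ (⋃ y ∈ u, (ball y (2 * ρ y) \ E)) := by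
          rw [ENNReal.tsum_mul_left, measure_biUnion huc
            (hud.mono fun y => Set.sdiff_subset) fun y _ => measurableSet_ball.diff hE]
      _ ≤ L * μ ((⋃ y ∈ u, ball y (2 * ρ y)) \ E) := by
          simp only [Set.iUnion_sdiff]
          gcongr
          exact le_add_self

/-- Each expansion reaches `2 * τ` further out and multiplies the weighted measure by at least the
growth factor. The volume hypothesis pays in advance for the growth of Lebesgue measure, so that `n`
expansions are admissible. -/
theorem exists_iterated_expansion (hw : IsMuckenhoupt q A w) {x : EuclideanSpace ℝ (Fin d)} {τ : ℝ}
    (hτ : 0 < τ) (n : ℕ) :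
    ∀ (R : ℝ) (E : Set (EuclideanSpace ℝ (Fin d))), MeasurableSet E → E ⊆ ball x R →
      (1 + ENNReal.ofReal (2 ^ d) * 2) ^ n * (2 * volume E) ≤ volume (ball x τ) →
      (1 + (growthConst d q A)⁻¹) ^ n * volume.withDensity w E ≤
        volume.withDensity w (ball x (R + n * (2 * τ))) := by
  induction n with
  | zero => intro R E _ hER _; simpa using measure_mono hER
  | succ n ih =>
    intro R E hE hER hvol
    set P : ℝ≥0∞ := 1 + ENNReal.ofReal (2 ^ d) * 2 with hP
    have hP1 : 1 ≤ P := le_self_add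
    obtain ⟨E', hE', hER', hv, hm⟩ := hw.exists_expansion hτ hE hER
      ((le_mul_of_one_le_left zero_le (one_le_pow₀ hP1)).trans hvol)
    have h := ih (R + 2 * τ) E' hE' hER' (le_trans (by
      calc P ^ n * (2 * volume E') ≤ P ^ n * (2 * (P * volume E)) := by gcongr
        _ = P ^ (n + 1) * (2 * volume E) := by ring) hvol)
    calc (1 + (growthConst d q A)⁻¹) ^ (n + 1) * volume.withDensity w E
        = (1 + (growthConst d q A)⁻¹) ^ n *
          ((1 + (growthConst d q A)⁻¹) * volume.withDensity w E) := by ring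
      _ ≤ (1 + (growthConst d q A)⁻¹) ^ n * volume.withDensity w E' := by gcongr
      _ ≤ _ := h
      _ = _ := by congr 2; push_cast; ring

end IsMuckenhoupt

theorem exists_le_one_add_pow {a : ℝ≥0∞} (ha : a ≠ 0) {b : ℝ≥0∞} (hb : b ≠ ∞) :
    ∃ n : ℕ, b ≤ (1 + a) ^ n := by
  have h := ENNReal.tendsto_pow_atTop_nhds_top_iff.2
    (ENNReal.lt_add_right ENNReal.one_ne_top ha)
  obtain ⟨n, hn⟩ := (h.eventually (lt_mem_nhds hb.lt_top)).exists
  exact ⟨n, hn.le⟩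

/-- **The `A_∞` property**, uniformly over weights with a given bound for the `A_q` constant. -/
theorem exists_forall_withDensity_le (d : ℕ) (q : ℝ) {A : ℝ≥0∞} (hA : A ≠ ∞) {δ : ℝ≥0∞}
    (hδ : δ ≠ 0) :
    ∃ ε : ℝ≥0∞, ε ≠ 0 ∧ ∀ w : EuclideanSpace ℝ (Fin d) → ℝ≥0∞, IsMuckenhoupt q A w →
      ∀ (x : EuclideanSpace ℝ (Fin d)) (r : ℝ), 0 < r →
      ∀ E : Set (EuclideanSpace ℝ (Fin d)), MeasurableSet E → E ⊆ ball x r →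
      volume E ≤ ε * volume (ball x r) →
      volume.withDensity w E ≤ δ * volume.withDensity w (ball x r) := by
  by_cases hq : 1 < q
  swap
  · exact ⟨1, one_ne_zero, fun w hw => absurd hw.one_lt hq⟩
  have hL : IsMuckenhoupt.growthConst d q A ≠ ∞ :=
    ENNReal.add_ne_top.2 ⟨ENNReal.one_ne_top, ENNReal.mul_ne_top
      (ENNReal.mul_ne_top hA (ENNReal.rpow_ne_top_of_nonneg (by linarith) ENNReal.ofReal_ne_top))
      (ENNReal.mul_ne_top (ENNReal.rpow_ne_top_of_nonneg (by linarith) (by simp)) hA)⟩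
  have hD : A * ENNReal.ofReal (6 ^ d) ^ q ≠ ∞ :=
    ENNReal.mul_ne_top hA (ENNReal.rpow_ne_top_of_nonneg (by linarith) ENNReal.ofReal_ne_top)
  -- Enough expansions for the accumulated growth to exceed the doubling constant divided by `δ`.
  obtain ⟨n, hn⟩ := exists_le_one_add_pow (ENNReal.inv_ne_zero.2 hL)
    (ENNReal.div_ne_top hD hδ)
  set P : ℝ≥0∞ := 1 + ENNReal.ofReal (2 ^ d) * 2 with hP
  have hPt : P ^ n * 2 ≠ ∞ := ENNReal.mul_ne_top (ENNReal.pow_ne_top (ENNReal.add_ne_top.2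
    ⟨ENNReal.one_ne_top, ENNReal.mul_ne_top ENNReal.ofReal_ne_top (by simp)⟩)) (by simp)
  have hP0 : P ^ n * 2 ≠ 0 := mul_ne_zero (pow_ne_zero _ (by simp [hP])) (by simp)
  -- With `τ = c * r`, all `n` expansions together move outward by at most `r`, well within the
  -- sixfold ball.
  set c : ℝ := 1 / (2 * (n + 1)) with hc
  have hc0 : 0 < c := by positivity
  refine ⟨ENNReal.ofReal (c ^ d) / (P ^ n * 2), ?_, fun w hw x r hr E hE hEr hvol => ?_⟩
  · exact ENNReal.div_ne_zero.2 ⟨by simp; positivity, hPt⟩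
  have h := hw.exists_iterated_expansion (mul_pos hc0 hr) n r E hE hEr (by
    rw [volume_ball_mul x x hc0, ← mul_assoc]
    calc P ^ n * 2 * volume E ≤ P ^ n * 2 *
          (ENNReal.ofReal (c ^ d) / (P ^ n * 2) * volume (ball x r)) := by gcongr
      _ = _ := by rw [← mul_assoc, ENNReal.mul_div_cancel hP0 hPt])
  have hrad : r + n * (2 * (c * r)) ≤ 6 * r := by
    have : (n : ℝ) * (2 * c) ≤ 1 := by
      rw [hc]; field_simp; linarith
    nlinarith
  set G := (1 + (IsMuckenhoupt.growthConst d q A)⁻¹) ^ n with hG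
  have hG0 : G ≠ 0 := pow_ne_zero _ (by simp)
  have hGt : G ≠ ∞ := ENNReal.pow_ne_top (ENNReal.add_ne_top.2 ⟨ENNReal.one_ne_top,
    ENNReal.inv_ne_top.2 (by simp [IsMuckenhoupt.growthConst])⟩)
  refine (ENNReal.mul_le_mul_iff_right hG0 hGt).1 (h.trans ?_)
  refine (measure_mono (ball_subset_ball hrad)).trans
    ((hw.doublingOnBalls.enlarge x r hr).trans ?_)
  rw [← mul_assoc]
  refine mul_le_mul_left ?_ _
  rcases eq_or_ne δ ∞ with rfl | hδt
  · rw [ENNReal.mul_top hG0]; exact le_top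
  · exact (ENNReal.div_le_iff hδ hδt).1 hn

end SmallSets

/-! ### The good-`λ` inequality. -/

section GoodLambda

variable {d : ℕ}

namespace IsMuckenhoupt

variable {q : ℝ} {A : ℝ≥0∞} {w : EuclideanSpace ℝ (Fin d) → ℝ≥0∞}

/-- The classes `A_q` increase with `q`. -/
theorem mono_exponent (hw : IsMuckenhoupt q A w) {s : ℝ} (hqs : q < s) : IsMuckenhoupt s A w := by
  have hq : 0 < q - 1 := sub_pos.2 hw.one_lt
  have hs : 0 < s - 1 := by linarith
  have hsq : 0 < s - q := by linarith
  refine ⟨by linarith [hw.one_lt], hw.const_ne_top, hw.measurable, hw.ne_zero, hw.ne_top,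
    fun x r hr => ?_⟩
  set v := volume (ball x r) with hv
  have hv0 : v ≠ 0 := volume_ball_ne_zero x hr
  have hvt : v ≠ ∞ := volume_ball_ne_top x r
  have hc : ((s - 1) / (q - 1)).HolderConjugate ((s - 1) / (s - q)) := by
    rw [Real.holderConjugate_iff]
    refine ⟨(one_lt_div hq).2 (by linarith), ?_⟩
    field_simp
    ring
  have hH := ENNReal.lintegral_mul_le_Lp_mul_Lq (volume.restrict (ball x r)) hc
    (f := dualWeight s w) (g := 1) (hw.measurable.pow_const _).aemeasurable aemeasurable_one
  have e : ∀ y, dualWeight s w y ^ ((s - 1) / (q - 1)) = dualWeight q w y := by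
    intro y
    rw [dualWeight, dualWeight, ← ENNReal.rpow_mul]
    congr 1
    field_simp
  simp only [mul_one, e, Pi.one_apply, ENNReal.one_rpow, setLIntegral_one, ← hv] at hH
  have hH' := ENNReal.rpow_le_rpow hH hs.le
  rw [ENNReal.mul_rpow_of_nonneg _ _ hs.le, ← ENNReal.rpow_mul, ← ENNReal.rpow_mul,
    show 1 / ((s - 1) / (q - 1)) * (s - 1) = q - 1 by field_simp,
    show 1 / ((s - 1) / (s - q)) * (s - 1) = s - q by field_simp] at hH'
  calc _ ≤ (∫⁻ y in ball x r, w y) *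
        ((∫⁻ y in ball x r, dualWeight q w y) ^ (q - 1) * v ^ (s - q)) := mul_le_mul_right hH' _
    _ = ((∫⁻ y in ball x r, w y) * (∫⁻ y in ball x r, dualWeight q w y) ^ (q - 1)) *
        v ^ (s - q) := by ring
    _ ≤ A * v ^ q * v ^ (s - q) := mul_le_mul_left (hw.bound x r hr) _
    _ = A * v ^ s := by
        rw [mul_assoc, ← ENNReal.rpow_add _ _ hv0 hvt]; congr 2; ring

/-- The weighted weak type `(q,q)` inequality for the maximal function. -/
theorem weak_type_rpow (hw : IsMuckenhoupt q A w) (R : ℝ) {φ : EuclideanSpace ℝ (Fin d) → ℝ≥0∞}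
    (hφ : Measurable φ) (t : ℝ≥0∞) :
    t ^ q * volume.withDensity w {x | t < maxFun volume R φ x} ≤
      A * ENNReal.ofReal (6 ^ d) ^ q * A * ∫⁻ x, φ x ^ q * w x := by
  have hq0 : 0 < q := by linarith [hw.one_lt]
  -- By Jensen against the weight, the `q`-th power of a Lebesgue average is at most a weighted
  -- average of `A * φ ^ q`; the weak type `(1,1)` bound for the weighted measure then suffices.
  have hsub : {x | t < maxFun volume R φ x} ⊆
      {x | t ^ q < maxFun (volume.withDensity w) R (fun y => A * φ y ^ q) x} := by
    intro x hx
    obtain ⟨z, r, h0, hR, hxz, ht⟩ := lt_maxFun_iff.1 hx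
    refine lt_maxFun_iff.2 ⟨z, r, h0, hR, hxz, ?_⟩
    have hW0 := hw.doublingOnBalls.pos z r h0
    have hWt := hw.doublingOnBalls.finite z r h0
    have hv0 := rpow_ne_zero_of_nonneg (volume_ball_ne_zero z h0) hq0.le
    have hvt := ENNReal.rpow_ne_top_of_nonneg hq0.le (volume_ball_ne_top z r)
    have h1 := ENNReal.rpow_lt_rpow ht hq0
    rw [ENNReal.div_rpow_of_nonneg _ _ hq0.le] at h1
    refine h1.trans_le ?_
    rw [ENNReal.le_div_iff_mul_le (Or.inl hW0) (Or.inl hWt),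
      setLIntegral_withDensity_eq hw.measurable ((hφ.pow_const q).const_mul A) measurableSet_ball,
      ← ENNReal.mul_div_right_comm, ENNReal.div_le_iff hv0 hvt,
      withDensity_apply _ measurableSet_ball]
    refine (hw.lintegral_rpow_mul_le z h0 hφ.aemeasurable).trans (le_of_eq ?_)
    simp_rw [mul_assoc A]
    rw [lintegral_const_mul' _ _ hw.const_ne_top]
    ring
  calc _ ≤ t ^ q * volume.withDensity w
        {x | t ^ q < maxFun (volume.withDensity w) R (fun y => A * φ y ^ q) x} := by gcongr
    _ ≤ _ := hw.doublingOnBalls.weak_type R _ _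
    _ = _ := by
      rw [lintegral_const_mul _ (hφ.pow_const q),
        lintegral_withDensity_eq hw.measurable (hφ.pow_const q)]
      ring

end IsMuckenhoupt

/-- A ball centred in `ball c R` meets `ball c R` in a set of comparable measure. -/
theorem DoublingOnBalls.ball_le_inter {μ : Measure (EuclideanSpace ℝ (Fin d))} {D : ℝ≥0∞}
    (hμ : DoublingOnBalls μ D) {c y : EuclideanSpace ℝ (Fin d)} {R ρ : ℝ} (hρ : 0 < ρ)
    (hρR : ρ ≤ R) (hy : y ∈ ball c R) :
    μ (ball y (6 * ρ)) ≤ D * D * μ (ball y ρ ∩ ball c R) := by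
  rw [mem_ball] at hy
  -- Move `y` towards `c` by `ρ / 2`, or to `c` itself if that is nearer: the ball of radius `ρ / 4`
  -- there lies in both balls, and two sixfold enlargements of it cover `ball y (6 * ρ)`.
  obtain ⟨y', h1, h2⟩ : ∃ y', dist y' y ≤ ρ / 2 ∧ dist y' c + ρ / 4 ≤ R := by
    rcases le_or_gt (dist y c) (ρ / 2) with h | h
    · exact ⟨c, by rwa [dist_comm], by simp; linarith⟩
    · have hm : 0 < dist y c := by linarith
      refine ⟨AffineMap.lineMap y c (ρ / (2 * dist y c)), ?_, ?_⟩
      · rw [dist_lineMap_left, Real.norm_of_nonneg (by positivity)]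
        apply le_of_eq; field_simp
      · rw [dist_lineMap_right, Real.norm_of_nonneg]
        · have : (1 - ρ / (2 * dist y c)) * dist y c = dist y c - ρ / 2 := by field_simp
          rw [this]; linarith
        · rw [sub_nonneg, div_le_one (by positivity)]; linarith
  have hs : ball y' (ρ / 4) ⊆ ball y ρ ∩ ball c R :=
    Set.subset_inter (ball_subset_ball' (by linarith)) (ball_subset_ball' (by linarith))
  have hs' : ball y (6 * ρ) ⊆ ball y' (6 * (6 * (ρ / 4))) :=
    ball_subset_ball' (by rw [dist_comm]; linarith)
  calc μ (ball y (6 * ρ)) ≤ μ (ball y' (6 * (6 * (ρ / 4)))) := measure_mono hs'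
    _ ≤ D * (D * μ (ball y' (ρ / 4))) := (hμ.enlarge _ _ (by positivity)).trans
        (mul_le_mul_right (hμ.enlarge _ _ (by positivity)) _)
    _ ≤ D * (D * μ (ball y ρ ∩ ball c R)) := by gcongr
    _ = _ := by ring

/-- Compare volumes. In dimension 0 all balls of positive radius coincide, hence the condition on
`d`. -/
theorem radius_le_of_ball_subset (hd : 1 ≤ d) {x y : EuclideanSpace ℝ (Fin d)} {r s : ℝ}
    (hs : 0 < s) (h : ball x r ⊆ ball y s) : r ≤ s := by
  by_contra! hlt
  have h1 := measure_mono (μ := volume) h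
  have hr : r = (r / s) * s := by field_simp
  have hlt' : 1 < r / s := (one_lt_div hs).2 hlt
  rw [hr, volume_ball_mul x y (by linarith)] at h1
  have : volume (ball y s) < ENNReal.ofReal ((r / s) ^ d) * volume (ball y s) := by
    conv_lhs => rw [← one_mul (volume (ball y s))]
    refine ENNReal.mul_lt_mul_left (volume_ball_ne_zero y hs) (volume_ball_ne_top y s) ?_
    rw [← ENNReal.ofReal_one]
    exact (ENNReal.ofReal_lt_ofReal_iff (by positivity)).2
      (one_lt_pow₀ hlt' (by omega))
  exact absurd h1 (not_le.2 this)

/-- At every ball of radius at most `κ * R` centred in `ball c R` on whose enlargements the averages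
of `g` and `h` are at most `t` and `γ * t`, the function `g` is dominated on the doubled ball by a
sum of two functions, one of small average and one with a bounded weighted `L^s` average. -/
def LocallyApproximable (w g h : EuclideanSpace ℝ (Fin d) → ℝ≥0∞) (c : EuclideanSpace ℝ (Fin d))
    (R κ s : ℝ) (γ ε K : ℝ≥0∞) : Prop :=
  ∀ (y : EuclideanSpace ℝ (Fin d)) (r : ℝ), 0 < r → r ≤ κ * R → y ∈ ball c R →
    ∀ t : ℝ≥0∞, t ≠ 0 → t ≠ ∞ →
    ∫⁻ x in ball y (100 * r), g x ≤ t * volume (ball y (100 * r)) →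
    (∀ (z : EuclideanSpace ℝ (Fin d)) (ρ : ℝ), ball y r ⊆ ball z ρ → ball z ρ ⊆ ball c (4 * R) →
      ∫⁻ x in ball z ρ, h x ≤ γ * t * volume (ball z ρ)) →
    ∃ G H : EuclideanSpace ℝ (Fin d) → ℝ≥0∞, Measurable G ∧ Measurable H ∧
      (∀ᵐ x ∂(volume.restrict (ball y (2 * r))), g x ≤ G x + H x) ∧
      ∫⁻ x in ball y (2 * r), G x ≤ ε * t * volume (ball y r) ∧
      ∫⁻ x in ball y (2 * r), H x ^ s * w x ≤ K * t ^ s * volume.withDensity w (ball y r)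

/-- The good-`λ` estimate on one ball of the covering. -/
theorem withDensity_inter_lt_maxFun_le {s : ℝ} {A a ε ε' δ θ K t : ℝ≥0∞}
    {w g G H : EuclideanSpace ℝ (Fin d) → ℝ≥0∞}
    (hws : IsMuckenhoupt s A w) (ha1 : 1 ≤ a) (ha : a ≠ ∞)
    (ht0 : t ≠ 0) (htt : t ≠ ∞) {y : EuclideanSpace ℝ (Fin d)} {r R : ℝ}
    (hsmall : ∀ E : Set (EuclideanSpace ℝ (Fin d)), MeasurableSet E → E ⊆ ball y r →
      volume E ≤ ε * volume (ball y r) →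
      volume.withDensity w E ≤ δ * volume.withDensity w (ball y r))
    (hε' : ENNReal.ofReal (6 ^ d) * ε' * 2 ≤ ε)
    (hθ : A * ENNReal.ofReal (6 ^ d) ^ s * A * K ≤ θ * (a / 2) ^ s)
    (hG : Measurable G) (hH : Measurable H)
    (hgGH : ∀ᵐ x ∂(volume.restrict (ball y (2 * r))), g x ≤ G x + H x)
    (hGint : ∫⁻ x in ball y (2 * r), G x ≤ ε' * t * volume (ball y r))
    (hHint : ∫⁻ x in ball y (2 * r), H x ^ s * w x ≤
      K * t ^ s * volume.withDensity w (ball y r))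
    {T : Set (EuclideanSpace ℝ (Fin d))}
    (hT : ∀ x ∈ T ∩ ball y r, ∃ z ρ, 0 < ρ ∧ ρ ≤ R ∧ x ∈ ball z ρ ∧ ball z ρ ⊆ ball y (2 * r) ∧
      a * t * volume (ball z ρ) < ∫⁻ x in ball z ρ, g x) :
    volume.withDensity w (T ∩ ball y r) ≤ (δ + θ) * volume.withDensity w (ball y r) := by
  have hs0 : 0 < s := by linarith [hws.one_lt]
  set μ := volume.withDensity w with hμ
  -- If an average of `G + H` exceeds `a * t`, that of `G` or that of `H` exceeds half of it.
  set b := a * t / 2 with hb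
  have hb0 : b ≠ 0 := by
    simp only [hb, ne_eq, ENNReal.div_eq_zero_iff, mul_eq_zero, not_or]
    exact ⟨⟨(one_pos.trans_le ha1).ne', ht0⟩, by simp⟩
  have hbt : b ≠ ∞ := ENNReal.div_ne_top (ENNReal.mul_ne_top ha htt) (by simp)
  set G' := (ball y (2 * r)).indicator G with hG'
  set H' := (ball y (2 * r)).indicator H with hH'
  have hmG' : Measurable G' := hG.indicator measurableSet_ball
  have hmH' : Measurable H' := hH.indicator measurableSet_ball
  have hcov : T ∩ ball y r ⊆ ({x | b < maxFun volume R G' x} ∩ ball y r) ∪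
      {x | b < maxFun volume R H' x} := by
    intro x hx
    obtain ⟨z, ρ, hρ, hρR, hxz, hsub, hlt⟩ := hT x hx
    by_contra hcon
    simp only [Set.mem_union, Set.mem_inter_iff, Set.mem_ofPred_eq, not_or, not_and] at hcon
    have h1 : maxFun volume R G' x ≤ b := by
      by_contra! h; exact hcon.1 h hx.2
    have h2 : maxFun volume R H' x ≤ b := not_lt.1 hcon.2
    have h3 := (le_maxFun (μ := volume) G' hρ hρR hxz).trans h1
    have h4 := (le_maxFun (μ := volume) H' hρ hρR hxz).trans h2
    have hv0 := volume_ball_ne_zero z hρ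
    have hvt := volume_ball_ne_top z ρ
    rw [ENNReal.div_le_iff hv0 hvt] at h3 h4
    refine absurd hlt (not_lt.2 ?_)
    calc ∫⁻ x in ball z ρ, g x ≤ ∫⁻ x in ball z ρ, (G' x + H' x) := by
          refine setLIntegral_mono_ae (hmG'.add hmH').aemeasurable ?_
          filter_upwards [(ae_restrict_iff' measurableSet_ball).1 hgGH] with x hx hxz
          have := hsub hxz
          simpa [hG', hH', this] using hx this
      _ = (∫⁻ x in ball z ρ, G' x) + ∫⁻ x in ball z ρ, H' x := lintegral_add_left hmG' _
      _ ≤ b * volume (ball z ρ) + b * volume (ball z ρ) := add_le_add h3 h4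
      _ = a * t * volume (ball z ρ) := by rw [← add_mul, hb, ENNReal.add_halves]
  have hGE : μ ({x | b < maxFun volume R G' x} ∩ ball y r) ≤ δ * μ (ball y r) := by
    refine hsmall _ ((isOpen_lt_maxFun _ _ _ _).measurableSet.inter measurableSet_ball)
      Set.inter_subset_right ?_
    have hwk := doublingOnBalls_volume.weak_type R G' b
    rw [hG', lintegral_indicator measurableSet_ball] at hwk
    refine (measure_mono Set.inter_subset_left).trans ?_
    refine (ENNReal.mul_le_mul_iff_right hb0 hbt).1 (hwk.trans ?_)
    calc _ ≤ ENNReal.ofReal (6 ^ d) * (ε' * t * volume (ball y r)) := by gcongr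
      _ = (ENNReal.ofReal (6 ^ d) * ε' * 2) * (t / 2) * volume (ball y r) := by
          rw [mul_assoc _ 2, ENNReal.mul_div_cancel (by simp) (by simp)]; ring
      _ ≤ ε * (a * t / 2) * volume (ball y r) := by
          gcongr
          exact le_mul_of_one_le_left zero_le ha1
      _ = b * (ε * volume (ball y r)) := by rw [hb]; ring
  -- Here the integrability exponent `s` of `H` yields the decay `a ^ (-s)`, encoded in `hθ`.
  have hHE : μ {x | b < maxFun volume R H' x} ≤ θ * μ (ball y r) := by
    have hwk := hws.weak_type_rpow R hmH' b
    have e : ∀ x, H' x ^ s * w x = (ball y (2 * r)).indicator (fun x => H x ^ s * w x) x := by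
      intro x
      by_cases hx : x ∈ ball y (2 * r) <;> simp only [hH', Set.indicator, hx, if_true, if_false]
      simp [hs0]
    simp_rw [e] at hwk
    rw [lintegral_indicator measurableSet_ball] at hwk
    refine (ENNReal.mul_le_mul_iff_right (rpow_ne_zero_of_nonneg hb0 hs0.le)
      (ENNReal.rpow_ne_top_of_nonneg hs0.le hbt)).1 (hwk.trans ?_)
    calc _ ≤ A * ENNReal.ofReal (6 ^ d) ^ s * A * (K * t ^ s * μ (ball y r)) := by gcongr
      _ = (A * ENNReal.ofReal (6 ^ d) ^ s * A * K) * (t ^ s * μ (ball y r)) := by ring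
      _ ≤ θ * (a / 2) ^ s * (t ^ s * μ (ball y r)) := by gcongr
      _ = (a / 2 * t) ^ s * (θ * μ (ball y r)) := by
          rw [ENNReal.mul_rpow_of_nonneg _ _ hs0.le]; ring
      _ = _ := by rw [hb, ENNReal.mul_div_right_comm]
  calc μ (T ∩ ball y r) ≤ _ := measure_mono hcov
    _ ≤ _ := measure_union_le _ _
    _ ≤ δ * μ (ball y r) + θ * μ (ball y r) := add_le_add hGE hHE
    _ = _ := by ring

/-- The good-`λ` inequality. -/
theorem good_lambda (hd : 1 ≤ d) {q s κ : ℝ} {A a γ ε ε' δ θ K t : ℝ≥0∞}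
    {w g h : EuclideanSpace ℝ (Fin d) → ℝ≥0∞} {c : EuclideanSpace ℝ (Fin d)} {R : ℝ} (hR : 0 < R)
    (hw : IsMuckenhoupt q A w) (hqs : q < s) (ha8 : ENNReal.ofReal (8 ^ d) ≤ a) (ha : a ≠ ∞)
    (ht0 : t ≠ 0) (htt : t ≠ ∞) (hκ1 : κ ≤ 1)
    (hsmall : ∀ (y : EuclideanSpace ℝ (Fin d)) (r : ℝ), 0 < r →
      ∀ E : Set (EuclideanSpace ℝ (Fin d)), MeasurableSet E → E ⊆ ball y r →
      volume E ≤ ε * volume (ball y r) →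
      volume.withDensity w E ≤ δ * volume.withDensity w (ball y r))
    (hε' : ENNReal.ofReal (6 ^ d) * ε' * 2 ≤ ε)
    (hθ : A * ENNReal.ofReal (6 ^ d) ^ s * A * K ≤ θ * (a / 2) ^ s)
    (happrox : LocallyApproximable w g h c R κ s γ ε' K)
    (hgt : ∫⁻ x, g x ≤ t * volume (ball c (κ / 6 * R))) :
    volume.withDensity w (ball c R ∩ {x | a * t < maxFun volume (4 * R) g x}) ≤
      (A * ENNReal.ofReal (6 ^ d) ^ q) * (A * ENNReal.ofReal (6 ^ d) ^ q) *
        ((δ + θ) * volume.withDensity w (ball c R ∩ {x | t < maxFun volume (4 * R) g x}) +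
          volume.withDensity w (ball c R ∩ {x | γ * t < maxFun volume (4 * R) h x})) := by
  set μ := volume.withDensity w with hμ
  set D := A * ENNReal.ofReal (6 ^ d) ^ q with hD
  have hdbl : DoublingOnBalls μ D := hw.doublingOnBalls
  have ha1 : 1 ≤ a := le_trans (by
    rw [← ENNReal.ofReal_one]
    exact ENNReal.ofReal_le_ofReal (one_le_pow₀ (by norm_num))) ha8
  set T := ball c R ∩ {x | a * t < maxFun volume (4 * R) g x} with hT
  -- The radii of centred balls on which the average of `g` exceeds `t`. By `hgt` they stay below `κ
  -- / 6 * R`, so that the sixfold Vitali balls are admissible in `LocallyApproximable`.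
  let S : EuclideanSpace ℝ (Fin d) → Set ℝ := fun y =>
    {r | 0 < r ∧ t * volume (ball y r) < ∫⁻ x in ball y r, g x}
  have hSκ : ∀ y, ∀ r ∈ S y, r < κ / 6 * R := by
    rintro y r ⟨hr, hlt⟩
    by_contra! hcon
    refine absurd (hlt.trans_le ((setLIntegral_le_lintegral _ _).trans hgt)) (not_lt.2 ?_)
    refine mul_le_mul_right ?_ t
    rw [Measure.addHaar_ball_center volume c, ← Measure.addHaar_ball_center volume y]
    exact measure_mono (ball_subset_ball hcon)
  have hexit : ∀ y, (S y).Nonempty → ∃ r ∈ S y, ∀ r', 2 * r ≤ r' → r' ∉ S y := fun y hy =>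
    exists_mem_forall_two_mul_le_notMem hy (fun r hr => hr.1) ⟨_, fun r hr => (hSκ y r hr).le⟩
  choose! ρ hρS hρ using hexit
  have hTS : ∀ x ∈ T, (S x).Nonempty := by
    rintro x ⟨-, hx⟩
    obtain ⟨z, r, hr, -, hxz, hlt⟩ := lt_maxFun_iff.1 hx
    rw [doublingOnBalls_volume.lt_div_iff hr] at hlt
    -- Recentring at `x` doubles the radius; the resulting factor `2 ^ d` is absorbed by `a`.
    refine ⟨2 * r, by positivity, ?_⟩
    have hsub : ball z r ⊆ ball x (2 * r) := ball_subset_ball' (by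
      rw [mem_ball, dist_comm] at hxz; linarith)
    refine lt_of_le_of_lt ?_ (hlt.trans_le (lintegral_mono_set hsub))
    rw [volume_ball_mul x z two_pos, ← mul_assoc, mul_comm t]
    gcongr
    refine le_trans (ENNReal.ofReal_le_ofReal ?_) ha8
    gcongr; norm_num
  obtain ⟨u, huT, huc, hud, hcov⟩ := exists_disjoint_balls_covering T id ρ R
    (fun y hy => by
      have := hSκ y _ (hρS y (hTS y hy))
      nlinarith) (fun y hy => (hρS y (hTS y hy)).1)
  simp only [id] at hud hcov
  have := huc.to_subtype
  have hball : ∀ y ∈ u, μ (T ∩ ball y (6 * ρ y)) ≤ D * D * ((δ + θ) *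
      μ (ball y (ρ y) ∩ (ball c R ∩ {x | t < maxFun volume (4 * R) g x})) +
      μ (ball y (ρ y) ∩ (ball c R ∩ {x | γ * t < maxFun volume (4 * R) h x}))) := by
    intro y hy
    have hyT := huT hy
    obtain ⟨hρ0, hρt⟩ := hρS y (hTS y hyT)
    have hρκ := hSκ y _ (hρS y (hTS y hyT))
    have hρR : ρ y ≤ R := by nlinarith
    -- The selected balls may leave `ball c R`; the part inside still has comparable weighted
    -- measure.
    have hcomp := hdbl.ball_le_inter hρ0 hρR hyT.1
    -- Either all averages of `h` over larger balls are at most `γ * t` and the approximation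
    -- applies, or one is large and the whole of `ball y (ρ y)` lies in the level set of the maximal
    -- function of `h`.
    by_cases hgood : ∀ (z : EuclideanSpace ℝ (Fin d)) (σ : ℝ), ball y (6 * ρ y) ⊆ ball z σ →
        ball z σ ⊆ ball c (4 * R) → ∫⁻ x in ball z σ, h x ≤ γ * t * volume (ball z σ)
    · have hexit : ∀ r, 2 * ρ y ≤ r → ∫⁻ x in ball y r, g x ≤ t * volume (ball y r) := by
        intro r hr
        by_contra! hcon
        exact hρ y (hTS y hyT) r hr ⟨by linarith, hcon⟩
      obtain ⟨G, H, hG, hH, hgGH, hGint, hHint⟩ := happrox y (6 * ρ y) (by positivity)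
        (by linarith) hyT.1 t ht0 htt (hexit _ (by linarith)) hgood
      have h1 := withDensity_inter_lt_maxFun_le (hw.mono_exponent hqs) ha1 ha ht0 htt
        (hsmall y (6 * ρ y) (by positivity)) hε' hθ hG hH hgGH hGint hHint (R := 4 * R) (T := T) (by
          rintro x ⟨⟨-, hx⟩, hxy⟩
          obtain ⟨z, r, hr, hrR, hxz, hlt⟩ := lt_maxFun_iff.1 hx
          rw [doublingOnBalls_volume.lt_div_iff hr] at hlt
          have hd1 : dist z y < r + 6 * ρ y := by
            rw [mem_ball] at hxy hxz
            linarith [dist_triangle_left z y x]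
          -- Otherwise `ball z r ⊆ ball y (8 * r)`, past the stopping radius, where the average is
          -- at most `t`; this contradicts `a ≥ 8 ^ d`. Hence only balls inside `ball y (2 * (6 * ρ
          -- y))` matter.
          have hrρ : r < ρ y := by
            by_contra! hcon
            refine absurd hlt (not_lt.2 ?_)
            calc ∫⁻ x in ball z r, g x ≤ ∫⁻ x in ball y (8 * r), g x :=
                  lintegral_mono_set (ball_subset_ball' (by linarith))
              _ ≤ t * volume (ball y (8 * r)) := hexit _ (by linarith)
              _ = ENNReal.ofReal (8 ^ d) * t * volume (ball z r) := by
                  rw [volume_ball_mul y z (by norm_num)]; ring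
              _ ≤ a * t * volume (ball z r) := by gcongr
          exact ⟨z, r, hr, hrR, hxz, ball_subset_ball' (by linarith), hlt⟩)
      have h2 : ball y (ρ y) ∩ ball c R ⊆
          ball y (ρ y) ∩ (ball c R ∩ {x | t < maxFun volume (4 * R) g x}) := by
        rintro x ⟨hx1, hx2⟩
        refine ⟨hx1, hx2, lt_maxFun_iff.2 ⟨y, ρ y, hρ0, by linarith, hx1, ?_⟩⟩
        exact (doublingOnBalls_volume.lt_div_iff hρ0).2 hρt
      calc μ (T ∩ ball y (6 * ρ y)) ≤ (δ + θ) * μ (ball y (6 * ρ y)) := h1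
        _ ≤ (δ + θ) * (D * D *
            μ (ball y (ρ y) ∩ (ball c R ∩ {x | t < maxFun volume (4 * R) g x}))) := by
            gcongr
            exact hcomp.trans (by gcongr)
        _ = D * D * ((δ + θ) *
            μ (ball y (ρ y) ∩ (ball c R ∩ {x | t < maxFun volume (4 * R) g x}))) := by ring
        _ ≤ _ := by gcongr; exact le_self_add
    · push Not at hgood
      obtain ⟨z, σ, hyz, hzc, hlt⟩ := hgood
      have hσ0 : 0 < σ := nonempty_ball.1 ⟨y, hyz (mem_ball_self (by positivity))⟩
      have hσR : σ ≤ 4 * R := radius_le_of_ball_subset hd (by positivity) hzc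
      have h2 : ball y (ρ y) ∩ ball c R ⊆
          ball y (ρ y) ∩ (ball c R ∩ {x | γ * t < maxFun volume (4 * R) h x}) := by
        rintro x ⟨hx1, hx2⟩
        refine ⟨hx1, hx2, lt_maxFun_iff.2 ⟨z, σ, hσ0, hσR,
          hyz (ball_subset_ball (by linarith) hx1), ?_⟩⟩
        exact (doublingOnBalls_volume.lt_div_iff hσ0).2 hlt
      calc μ (T ∩ ball y (6 * ρ y)) ≤ μ (ball y (6 * ρ y)) := measure_mono Set.inter_subset_right
        _ ≤ D * D * μ (ball y (ρ y) ∩ (ball c R ∩ {x | γ * t < maxFun volume (4 * R) h x})) :=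
            hcomp.trans (by gcongr)
        _ ≤ _ := by gcongr; exact le_add_self
  have hsum : ∀ E : Set (EuclideanSpace ℝ (Fin d)), MeasurableSet E →
      ∑' y : u, μ (ball y.1 (ρ y) ∩ E) ≤ μ E := by
    intro E hE
    rw [← measure_biUnion huc (hud.mono fun y => Set.inter_subset_left)
      fun y _ => measurableSet_ball.inter hE]
    exact measure_mono (Set.iUnion₂_subset fun y _ => Set.inter_subset_right)
  have hmE : ∀ (φ : EuclideanSpace ℝ (Fin d) → ℝ≥0∞) (b : ℝ≥0∞),
      MeasurableSet (ball c R ∩ {x | b < maxFun volume (4 * R) φ x}) := fun φ b =>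
    measurableSet_ball.inter (isOpen_lt_maxFun _ _ _ _).measurableSet
  have hTsub : T ⊆ ⋃ y ∈ u, T ∩ ball y (6 * ρ y) := by
    intro x hx
    have := hcov (Set.mem_biUnion hx (mem_ball_self (hρS x (hTS x hx)).1))
    simp only [Set.mem_iUnion] at this ⊢
    obtain ⟨y, hy, hxy⟩ := this
    exact ⟨y, hy, hx, hxy⟩
  calc μ T ≤ ∑' y : u, μ (T ∩ ball y.1 (6 * ρ y)) := by
        refine (measure_mono hTsub).trans ?_
        rw [Set.biUnion_eq_iUnion]; exact measure_iUnion_le _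
    _ ≤ ∑' y : u, D * D * ((δ + θ) *
        μ (ball y.1 (ρ y) ∩ (ball c R ∩ {x | t < maxFun volume (4 * R) g x})) +
        μ (ball y.1 (ρ y) ∩ (ball c R ∩ {x | γ * t < maxFun volume (4 * R) h x}))) :=
        ENNReal.tsum_le_tsum fun y => hball y y.2
    _ ≤ _ := by
        rw [ENNReal.tsum_mul_left, ENNReal.tsum_add, ENNReal.tsum_mul_left]
        gcongr
        · exact hsum _ (hmE _ _)
        · exact hsum _ (hmE _ _)

end GoodLambda

/-! ### Integration of the good-`λ` inequality and choice of parameters. -/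

section GoodLambdaIntegration

/-- The distribution function is antitone, hence measurable whatever `φ` is. -/
theorem measurable_rpow_mul_measure_lt {X : Type*} [MeasurableSpace X] (μ : Measure X)
    (φ : X → ℝ≥0∞) (r : ℝ) :
    Measurable fun t : ℝ => ENNReal.ofReal (t ^ r) * μ {x | ENNReal.ofReal t < φ x} := by
  refine (ENNReal.measurable_ofReal.comp (measurable_id.pow_const _)).mul ?_
  refine Antitone.measurable fun t t' htt' => measure_mono fun x hx => ?_
  exact (ENNReal.ofReal_le_ofReal htt').trans_lt hx

/-- Integration of a good-`λ` inequality for a bounded function. -/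
theorem lintegral_rpow_le_of_good_lambda {X : Type*} [MetricSpace X] [MeasurableSpace X]
    [BorelSpace X] [SecondCountableTopology X] {μ : Measure X} [IsFiniteMeasure μ] {q : ℝ}
    (hq : 0 < q) {φ ψ : X → ℝ≥0∞} (hφ : Measurable φ) (hψ : Measurable ψ) {a l η B T : ℝ≥0∞}
    (ha1 : 1 ≤ a) (ha : a ≠ ∞) (hT : T ≠ ∞) (hη : 2 * η * a ^ q ≤ 1)
    (hgl : ∀ t : ℝ≥0∞, t ≠ 0 → t ≠ ∞ → l ≤ t →
      μ {x | a * t < φ x} ≤ η * μ {x | t < φ x} + B * μ {x | t < ψ x}) :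
    ∫⁻ x, min (φ x) T ^ q ∂μ ≤ 2 * a ^ q * (l ^ q * μ Set.univ + B * ∫⁻ x, ψ x ^ q ∂μ) := by
  have ha0 : a ≠ 0 := (one_pos.trans_le ha1).ne'
  have haq0 : a ^ q ≠ 0 := rpow_ne_zero_of_nonneg ha0 hq.le
  have haqt : a ^ q ≠ ∞ := ENNReal.rpow_ne_top_of_nonneg hq.le ha
  have hv : Measurable fun x => min (φ x) T := hφ.min measurable_const
  have hu : Measurable fun x => min (φ x) T / a := hv.div_const a
  -- The truncation at `T` serves to make this finite, so that it can be absorbed at the end.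
  have hfin : ∫⁻ x, min (φ x) T ^ q ∂μ ≠ ∞ := by
    refine ne_top_of_le_ne_top ?_ (lintegral_mono fun x =>
      ENNReal.rpow_le_rpow (min_le_right (φ x) T) hq.le)
    rw [lintegral_const]
    exact ENNReal.mul_ne_top (ENNReal.rpow_ne_top_of_nonneg hq.le hT) (measure_ne_top μ _)
  have hpt : ∀ t ∈ Set.Ioi (0 : ℝ), ENNReal.ofReal (t ^ (q - 1)) *
      μ {x | ENNReal.ofReal t < min (φ x) T / a} ≤
      ENNReal.ofReal (t ^ (q - 1)) * μ {_x | ENNReal.ofReal t < l} +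
      (η * (ENNReal.ofReal (t ^ (q - 1)) * μ {x | ENNReal.ofReal t < min (φ x) T}) +
        B * (ENNReal.ofReal (t ^ (q - 1)) * μ {x | ENNReal.ofReal t < ψ x})) := by
    intro t (ht : 0 < t)
    have key : μ {x | ENNReal.ofReal t < min (φ x) T / a} ≤ μ {_x | ENNReal.ofReal t < l} +
        (η * μ {x | ENNReal.ofReal t < min (φ x) T} + B * μ {x | ENNReal.ofReal t < ψ x}) := by
      -- Below `l` the total mass is used; above `T` the left side vanishes since `a ≥ 1`; in
      -- between, truncation does not change the level set on the right.
      rcases lt_or_ge (ENNReal.ofReal t) l with hl | hl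
      · refine le_add_right (measure_mono fun x _ => hl)
      rcases le_or_gt T (ENNReal.ofReal t) with hTt | hTt
      · have : {x | ENNReal.ofReal t < min (φ x) T / a} = ∅ := by
          refine Set.eq_empty_of_forall_notMem fun x hx => ?_
          refine absurd hx (not_lt.2 (le_trans ?_ hTt))
          exact (ENNReal.div_le_of_le_mul
            ((min_le_right (φ x) T).trans (le_mul_of_one_le_right zero_le ha1)))
        rw [this, measure_empty]; exact zero_le
      · refine le_add_left ?_
        have h1 : {x | ENNReal.ofReal t < min (φ x) T / a} ⊆ {x | a * ENNReal.ofReal t < φ x} := by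
          intro x hx
          have := (ENNReal.lt_div_iff_mul_lt (Or.inl ha0) (Or.inl ha)).1 hx
          rw [mul_comm] at this
          exact this.trans_le (min_le_left _ _)
        have h2 : {x | ENNReal.ofReal t < φ x} ⊆ {x | ENNReal.ofReal t < min (φ x) T} :=
          fun x hx => lt_min hx hTt
        refine (measure_mono h1).trans ((hgl _ (by simpa using ht) ENNReal.ofReal_ne_top hl).trans ?_)
        gcongr
    refine (mul_le_mul_right key _).trans (le_of_eq ?_)
    ring
  have hint := setLIntegral_mono' (μ := volume) measurableSet_Ioi hpt
  rw [lintegral_add_left (measurable_rpow_mul_measure_lt μ _ _),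
    lintegral_add_left ((measurable_rpow_mul_measure_lt μ _ _).const_mul _),
    lintegral_const_mul _ (measurable_rpow_mul_measure_lt μ _ _),
    lintegral_const_mul _ (measurable_rpow_mul_measure_lt μ _ _),
    lintegral_rpow_eq_layercake hq hu, lintegral_rpow_eq_layercake hq hv,
    lintegral_rpow_eq_layercake hq hψ, lintegral_rpow_eq_layercake hq measurable_const,
    lintegral_const] at hint
  have hc0 : ENNReal.ofReal (1 / q) ≠ 0 := by simpa using hq
  have hdiv : ∫⁻ x, (min (φ x) T / a) ^ q ∂μ = (a ^ q)⁻¹ * ∫⁻ x, min (φ x) T ^ q ∂μ := by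
    rw [← lintegral_const_mul _ (hv.pow_const q)]
    refine lintegral_congr fun x => ?_
    rw [ENNReal.div_rpow_of_nonneg _ _ hq.le, div_eq_mul_inv, mul_comm]
  set X := ∫⁻ x, min (φ x) T ^ q ∂μ with hX
  set Y := ∫⁻ x, ψ x ^ q ∂μ with hY
  have h1 : (a ^ q)⁻¹ * X ≤ l ^ q * μ Set.univ + (η * X + B * Y) := by
    refine (ENNReal.mul_le_mul_iff_right hc0 ENNReal.ofReal_ne_top).1 ?_
    rw [← hdiv]
    refine hint.trans (le_of_eq ?_)
    ring
  rw [ENNReal.inv_mul_le_iff haq0 haqt] at h1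
  have h2 : X + X ≤ X + 2 * a ^ q * (l ^ q * μ Set.univ + B * Y) := by
    calc X + X = 2 * X := (two_mul X).symm
      _ ≤ 2 * (a ^ q * (l ^ q * μ Set.univ + (η * X + B * Y))) := mul_le_mul_right h1 _
      _ = (2 * η * a ^ q) * X + 2 * a ^ q * (l ^ q * μ Set.univ + B * Y) := by ring
      _ ≤ 1 * X + 2 * a ^ q * (l ^ q * μ Set.univ + B * Y) := by gcongr
      _ = _ := by rw [one_mul]
  exact (ENNReal.add_le_add_iff_left hfin).1 h2

variable {d : ℕ}

/-- Existence of the parameters in the good-`λ` argument. -/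
theorem exists_good_lambda_params {q s : ℝ} (hq : 0 < q) (hqs : q < s) {D Y N : ℝ≥0∞}
    (hD : D ≠ ∞) (hY : Y ≠ ∞) (hN : N ≠ ∞) (hN1 : 1 ≤ N) :
    ∃ a δ θ : ℝ≥0∞, N ≤ a ∧ a ≠ ∞ ∧ δ ≠ 0 ∧ Y ≤ θ * (a / 2) ^ s ∧
      2 * (D * (δ + θ)) * a ^ q ≤ 1 := by
  have hs : 0 < s := by linarith
  have hsq : 0 < s - q := by linarith
  -- With `θ = Y * 2 ^ s / a ^ s` one has `4 * (D * θ) * a ^ q = X * a ^ q / a ^ s`, so `a ^ (s - q)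
  -- ≥ X` suffices; here `q < s` is essential.
  set X := D * 4 * Y * 2 ^ s with hX
  have hXt : X ≠ ∞ := ENNReal.mul_ne_top (ENNReal.mul_ne_top (ENNReal.mul_ne_top hD (by simp)) hY)
    (ENNReal.rpow_ne_top_of_nonneg hs.le (by simp))
  obtain ⟨a, hNa, hat, hXa⟩ : ∃ a, N ≤ a ∧ a ≠ ∞ ∧ X ≤ a ^ (s - q) := by
    refine ⟨max N (X ^ (s - q)⁻¹), le_max_left _ _, ?_, ?_⟩
    · exact (max_lt hN.lt_top (ENNReal.rpow_ne_top_of_nonneg (by positivity) hXt).lt_top).ne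
    · rw [← ENNReal.rpow_inv_le_iff hsq]; exact le_max_right _ _
  have ha0 : a ≠ 0 := (one_pos.trans_le (hN1.trans hNa)).ne'
  have has0 : a ^ s ≠ 0 := rpow_ne_zero_of_nonneg ha0 hs.le
  have hast : a ^ s ≠ ∞ := ENNReal.rpow_ne_top_of_nonneg hs.le hat
  have haqt : a ^ q ≠ ∞ := ENNReal.rpow_ne_top_of_nonneg hq.le hat
  have h2s0 : (2 : ℝ≥0∞) ^ s ≠ 0 := rpow_ne_zero_of_nonneg (by simp) hs.le
  have h2st : (2 : ℝ≥0∞) ^ s ≠ ∞ := ENNReal.rpow_ne_top_of_nonneg hs.le (by simp)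
  set δ := (D * 4 * a ^ q)⁻¹ with hδ
  set θ := Y * 2 ^ s / a ^ s with hθ
  have h1 : 4 * (D * δ) * a ^ q ≤ 1 := by
    calc 4 * (D * δ) * a ^ q = (D * 4 * a ^ q) * (D * 4 * a ^ q)⁻¹ := by rw [hδ]; ring
      _ ≤ 1 := ENNReal.mul_inv_le_one _
  have h2 : 4 * (D * θ) * a ^ q ≤ 1 := by
    calc 4 * (D * θ) * a ^ q = X * a ^ q / a ^ s := by
          rw [hθ, hX]; simp only [div_eq_mul_inv]; ring
      _ ≤ a ^ (s - q) * a ^ q / a ^ s := by gcongr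
      _ = 1 := by
          rw [← ENNReal.rpow_add _ _ ha0 hat, sub_add_cancel, ENNReal.div_self has0 hast]
  refine ⟨a, δ, θ, hNa, hat, ?_, ?_, ?_⟩
  · exact ENNReal.inv_ne_zero.2 (ENNReal.mul_ne_top (ENNReal.mul_ne_top hD (by simp)) haqt)
  · rw [hθ, ENNReal.div_rpow_of_nonneg _ _ hs.le, ← mul_div_assoc,
      ENNReal.div_mul_cancel has0 hast, ENNReal.mul_div_cancel_right h2s0 h2st]
  · have h3 : 2 * (2 * (D * (δ + θ)) * a ^ q) ≤ 2 * 1 := by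
      calc _ = 4 * (D * δ) * a ^ q + 4 * (D * θ) * a ^ q := by ring
        _ ≤ 1 + 1 := add_le_add h1 h2
        _ = _ := by norm_num
    exact (ENNReal.mul_le_mul_iff_right (by simp) (by simp)).1 h3

/-- A locally approximable function satisfies a weighted `L^q` estimate. -/
theorem exists_lintegral_rpow_le_of_locallyApproximable (hd : 1 ≤ d) {q s κ : ℝ} (hq : 1 < q)
    (hqs : q < s) (hκ0 : 0 < κ) (hκ1 : κ ≤ 1) {A K : ℝ≥0∞} (hA : A ≠ ∞) (hK : K ≠ ∞) :
    ∃ ε : ℝ≥0∞, ε ≠ 0 ∧ ∀ γ : ℝ≥0∞, γ ≠ 0 → γ ≠ ∞ → ∃ C : ℝ≥0∞, C ≠ ∞ ∧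
      ∀ (w g h : EuclideanSpace ℝ (Fin d) → ℝ≥0∞) (c : EuclideanSpace ℝ (Fin d)) (R : ℝ), 0 < R →
      IsMuckenhoupt q A w → Measurable g → Measurable h → ∫⁻ x, g x ≠ ∞ →
      LocallyApproximable w g h c R κ s γ ε K →
      ∫⁻ x in ball c R, g x ^ q * w x ≤
        C * (∫⁻ x, h x ^ q * w x) +
          C * ((∫⁻ x, g x) / volume (ball c R)) ^ q * ∫⁻ x in ball c R, w x := by
  have hq0 : 0 < q := by linarith
  set D := A * ENNReal.ofReal (6 ^ d) ^ q with hD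
  have hDt : D ≠ ∞ := ENNReal.mul_ne_top hA (ENNReal.rpow_ne_top_of_nonneg hq0.le (by simp))
  set Y := A * ENNReal.ofReal (6 ^ d) ^ s * A * K with hY
  have hYt : Y ≠ ∞ := ENNReal.mul_ne_top (ENNReal.mul_ne_top (ENNReal.mul_ne_top hA
    (ENNReal.rpow_ne_top_of_nonneg (by linarith) (by simp))) hA) hK
  obtain ⟨a, δ, θ, ha8, hat, hδ, hθ, hη⟩ := exists_good_lambda_params hq0 hqs
    (ENNReal.mul_ne_top hDt hDt) hYt (N := ENNReal.ofReal (8 ^ d)) ENNReal.ofReal_ne_top (by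
      rw [← ENNReal.ofReal_one]
      exact ENNReal.ofReal_le_ofReal (one_le_pow₀ (by norm_num)))
  have ha1 : 1 ≤ a := le_trans (by
    rw [← ENNReal.ofReal_one]
    exact ENNReal.ofReal_le_ofReal (one_le_pow₀ (by norm_num))) ha8
  -- The smallness `ε` depends on `a` and `δ` only through data fixed before `γ`. Below it is
  -- divided by the weak type constant `6 ^ d` and by the 2 from splitting `a * t` in half.
  obtain ⟨ε, hε, hsmall⟩ := exists_forall_withDensity_le d q hA hδ
  have h60 : ENNReal.ofReal (6 ^ d) * 2 ≠ 0 := mul_ne_zero (by simp) (by simp)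
  have h6t : ENNReal.ofReal (6 ^ d) * 2 ≠ ∞ := ENNReal.mul_ne_top (by simp) (by simp)
  refine ⟨ε / (ENNReal.ofReal (6 ^ d) * 2), ENNReal.div_ne_zero.2 ⟨hε, h6t⟩, fun γ hγ0 hγt => ?_⟩
  set k := ENNReal.ofReal ((κ / 6) ^ d) with hk
  have hk0 : k ≠ 0 := by simp only [hk, ne_eq, ENNReal.ofReal_eq_zero, not_le]; positivity
  have hkt : k ≠ ∞ := ENNReal.ofReal_ne_top
  refine ⟨2 * a ^ q * (D * D * ((γ ^ q)⁻¹ * IsMuckenhoupt.maxConst d q A)) +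
    2 * a ^ q * (k ^ q)⁻¹, ?_, ?_⟩
  · have h1 : 2 * a ^ q ≠ ∞ :=
      ENNReal.mul_ne_top (by simp) (ENNReal.rpow_ne_top_of_nonneg hq0.le hat)
    exact ENNReal.add_ne_top.2 ⟨ENNReal.mul_ne_top h1 (ENNReal.mul_ne_top
      (ENNReal.mul_ne_top hDt hDt) (ENNReal.mul_ne_top
        (ENNReal.inv_ne_top.2 (rpow_ne_zero_of_nonneg hγ0 hq0.le))
        (IsMuckenhoupt.maxConst_ne_top hq hA))),
      ENNReal.mul_ne_top h1 (ENNReal.inv_ne_top.2 (rpow_ne_zero_of_nonneg hk0 hq0.le))⟩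
  intro w g h c R hR hw hg hh hgt happrox
  set μ := volume.withDensity w with hμ
  set B := ball c R with hB
  have hv0 : volume B ≠ 0 := volume_ball_ne_zero c hR
  have hvt : volume B ≠ ∞ := volume_ball_ne_top c R
  -- For finite `t`, `l ≤ t` is exactly the bound on the total integral of `g` required by
  -- `good_lambda`.
  set l := (∫⁻ x, g x) / (k * volume B) with hl
  set Mg := maxFun volume (4 * R) g with hMg
  set Mh := maxFun volume (4 * R) h with hMh
  have hmMg : Measurable Mg := measurable_maxFun _ _ _
  have hmMh : Measurable Mh := measurable_maxFun _ _ _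
  have hμB : μ B ≠ ∞ := hw.doublingOnBalls.finite c R hR
  have : IsFiniteMeasure (μ.restrict B) := ⟨by simpa using hμB.lt_top⟩
  have hgl : ∀ t : ℝ≥0∞, t ≠ 0 → t ≠ ∞ → l ≤ t → μ.restrict B {x | a * t < Mg x} ≤
      D * D * (δ + θ) * μ.restrict B {x | t < Mg x} +
        D * D * μ.restrict B {x | t < Mh x / γ} := by
    intro t ht0 htt hlt
    have hset : {x | t < Mh x / γ} = {x | γ * t < Mh x} := by
      ext x
      simp only [Set.mem_ofPred_eq]
      rw [ENNReal.lt_div_iff_mul_lt (Or.inl hγ0) (Or.inl hγt), mul_comm]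
    have hm : ∀ (φ : EuclideanSpace ℝ (Fin d) → ℝ≥0∞) (b : ℝ≥0∞),
        μ.restrict B {x | b < maxFun volume (4 * R) φ x} =
          μ (B ∩ {x | b < maxFun volume (4 * R) φ x}) := fun φ b => by
      rw [Measure.restrict_apply (isOpen_lt_maxFun _ _ _ _).measurableSet, Set.inter_comm]
    rw [hset, hMg, hMh, hm, hm, hm]
    refine (good_lambda hd hR hw hqs ha8 hat ht0 htt hκ1 (ε := ε) (hsmall w hw) ?_ hθ happrox
      ?_).trans (le_of_eq (by ring))
    · rw [mul_right_comm, ENNReal.mul_div_cancel h60 h6t]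
    · rw [volume_ball_mul c c (by positivity), ← hk]
      rwa [hl, ENNReal.div_le_iff (mul_ne_zero hk0 hv0) (ENNReal.mul_ne_top hkt hvt)] at hlt
  -- The bound is uniform in the truncation level `n`, so monotone convergence removes it.
  have hMT : ∫⁻ x in B, Mg x ^ q ∂μ ≤
      2 * a ^ q * (l ^ q * μ B + D * D * ∫⁻ x in B, (Mh x / γ) ^ q ∂μ) := by
    have hT := fun n : ℕ => lintegral_rpow_le_of_good_lambda hq0 hmMg (hmMh.div_const γ) ha1 hat
      (ENNReal.natCast_ne_top n) (by simpa [mul_assoc] using hη) hgl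
    simp only [Measure.restrict_apply_univ] at hT
    refine le_of_tendsto' (x := Filter.atTop) ?_ hT
    refine lintegral_tendsto_of_tendsto_of_monotone
      (fun n => ((hmMg.min measurable_const).pow_const q).aemeasurable) ?_ ?_
    · refine Filter.Eventually.of_forall fun x m n hmn => ?_
      dsimp only
      gcongr
    · refine Filter.Eventually.of_forall fun x => ?_
      have h1 : Filter.Tendsto (fun n : ℕ => min (Mg x) (n : ℝ≥0∞)) Filter.atTop
          (nhds (min (Mg x) ∞)) := tendsto_const_nhds.min ENNReal.tendsto_nat_nhds_top
      rw [min_eq_left le_top] at h1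
      exact (ENNReal.continuous_rpow_const (y := q)).continuousAt.tendsto.comp h1
  have hgM : ∀ᵐ x, g x ≤ Mg x := by
    filter_upwards [ae_exists_ball_lt_setLIntegral hg hgt] with x hx
    refine le_of_forall_lt fun t ht => ?_
    obtain ⟨r, hr, hrR, hlt⟩ := hx t ht (4 * R) (by positivity)
    exact lt_maxFun_iff.2 ⟨x, r, hr, hrR, mem_ball_self hr,
      (doublingOnBalls_volume.lt_div_iff hr).2 hlt⟩
  have hMhγ : ∫⁻ x in B, (Mh x / γ) ^ q ∂μ ≤
      (γ ^ q)⁻¹ * (IsMuckenhoupt.maxConst d q A * ∫⁻ x, h x ^ q * w x) := by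
    calc ∫⁻ x in B, (Mh x / γ) ^ q ∂μ ≤ ∫⁻ x, (Mh x / γ) ^ q ∂μ := setLIntegral_le_lintegral _ _
      _ = (γ ^ q)⁻¹ * ∫⁻ x, Mh x ^ q ∂μ := by
          rw [← lintegral_const_mul _ (hmMh.pow_const q)]
          refine lintegral_congr fun x => ?_
          rw [ENNReal.div_rpow_of_nonneg _ _ hq0.le, div_eq_mul_inv, mul_comm]
      _ ≤ _ := by
          rw [← lintegral_withDensity_eq hw.measurable (hh.pow_const q)]
          exact mul_le_mul_right (hw.lintegral_maxFun_rpow_le _ hh) _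
  have hlq : l ^ q = (k ^ q)⁻¹ * ((∫⁻ x, g x) / volume B) ^ q := by
    rw [← ENNReal.inv_rpow, ← ENNReal.mul_rpow_of_nonneg _ _ hq0.le, hl, div_eq_mul_inv,
      ENNReal.mul_inv (Or.inl hk0) (Or.inl hkt), div_eq_mul_inv]
    congr 1; ring
  set I := ∫⁻ x, h x ^ q * w x with hI
  set J := ((∫⁻ x, g x) / volume B) ^ q with hJ
  calc ∫⁻ x in B, g x ^ q * w x ≤ ∫⁻ x in B, Mg x ^ q * w x := by
        refine lintegral_mono_ae (ae_restrict_of_ae ?_)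
        filter_upwards [hgM] with x hx
        gcongr
    _ = ∫⁻ x in B, Mg x ^ q ∂μ :=
        (setLIntegral_withDensity_eq hw.measurable (hmMg.pow_const q) measurableSet_ball).symm
    _ ≤ _ := hMT
    _ ≤ 2 * a ^ q * ((k ^ q)⁻¹ * J * μ B +
        D * D * ((γ ^ q)⁻¹ * (IsMuckenhoupt.maxConst d q A * I))) := by
        rw [hlq]; gcongr
    _ = 2 * a ^ q * (D * D * ((γ ^ q)⁻¹ * IsMuckenhoupt.maxConst d q A)) * I +
        2 * a ^ q * (k ^ q)⁻¹ * J * ∫⁻ x in B, w x := by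
        rw [hμ, withDensity_apply _ measurableSet_ball]; ring
    _ ≤ _ := by gcongr <;> simp

end GoodLambdaIntegration

/-! ### From the hypotheses of the theorem to `LocallyApproximable`. -/

section Translation

variable {d : ℕ}

theorem exists_measurable_ae_eq_indicator {X : Type*} [MeasurableSpace X] {μ : Measure X}
    {B : Set X} (hB : MeasurableSet B) {F : X → ℝ≥0∞} (hF : AEMeasurable F (μ.restrict B)) :
    ∃ g : X → ℝ≥0∞, Measurable g ∧ g =ᵐ[μ] B.indicator F := by
  obtain ⟨g, hg, hFg⟩ := (aemeasurable_indicator_iff hB).2 hF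
  exact ⟨g, hg, hFg.symm⟩

theorem setLIntegral_rpow_mul_eq_of_ae_eq_indicator {X : Type*} [MeasurableSpace X] {μ : Measure X}
    {B E : Set X} (hE : MeasurableSet E) (hEB : E ⊆ B) {F g w : X → ℝ≥0∞}
    (h : g =ᵐ[μ] B.indicator F) (q : ℝ) :
    ∫⁻ x in E, g x ^ q * w x ∂μ = ∫⁻ x in E, F x ^ q * w x ∂μ := by
  refine setLIntegral_congr_fun_ae hE ?_
  filter_upwards [h] with x hx hxE
  rw [hx, Set.indicator_of_mem (hEB hxE)]

theorem setLIntegral_eq_of_ae_eq_indicator {X : Type*} [MeasurableSpace X] {μ : Measure X}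
    {B E : Set X} (hE : MeasurableSet E) (hEB : E ⊆ B) {F g : X → ℝ≥0∞}
    (h : g =ᵐ[μ] B.indicator F) :
    ∫⁻ x in E, g x ∂μ = ∫⁻ x in E, F x ∂μ := by
  refine setLIntegral_congr_fun_ae hE ?_
  filter_upwards [h] with x hx hxE
  rw [hx, Set.indicator_of_mem (hEB hxE)]

/-- The constant is crude but valid for all `r ≥ 0`, so that `p₀ < 1` needs no separate treatment.
-/
theorem ENNReal.add_rpow_le_two_rpow_mul (x y : ℝ≥0∞) {r : ℝ} (hr : 0 ≤ r) :
    (x + y) ^ r ≤ 2 ^ r * (x ^ r + y ^ r) := by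
  have h : x + y ≤ 2 * max x y := by
    rw [two_mul]; exact add_le_add (le_max_left _ _) (le_max_right _ _)
  refine (ENNReal.rpow_le_rpow h hr).trans ?_
  rw [ENNReal.mul_rpow_of_nonneg _ _ hr]
  gcongr
  rcases le_total x y with hxy | hxy
  · rw [max_eq_right hxy]; exact le_add_self
  · rw [max_eq_left hxy]; exact le_self_add

theorem avgPow_rpow {q : ℝ} (hq : 0 < q) (g : EuclideanSpace ℝ (Fin d) → ℝ)
    (E : Set (EuclideanSpace ℝ (Fin d))) :
    avgPow q g E ^ q = (∫⁻ x in E, ‖g x‖ₑ ^ q) / volume E := by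
  rw [avgPow, ← ENNReal.rpow_mul, one_div_mul_cancel hq.ne', ENNReal.rpow_one, setLAverage_eq]

theorem avgPowWeighted_rpow {q : ℝ} (hq : 0 < q) (ω g : EuclideanSpace ℝ (Fin d) → ℝ)
    (E : Set (EuclideanSpace ℝ (Fin d))) :
    avgPowWeighted q ω g E ^ q = (∫⁻ x in E, ‖g x‖ₑ ^ q * ENNReal.ofReal (ω x)) / volume E := by
  rw [avgPowWeighted, ← ENNReal.rpow_mul, one_div_mul_cancel hq.ne', ENNReal.rpow_one,
    setLAverage_eq]

/-- Admissible constants form an upward closed set, and the inequality passes to the limit from the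
right, so the infimum is itself admissible. -/
theorem apBound_of_apConstant_le {q : ℝ} {ω : EuclideanSpace ℝ (Fin d) → ℝ} {A : ℝ}
    (hω : IsApWeight q ω) (hA : apConstant q ω ≤ A) : ApBound q ω A := by
  have hbdd : BddBelow {C : ℝ | ApBound q ω C} := ⟨1, fun C hC => hC.1⟩
  have key : ∀ C, A < C → ApBound q ω C := fun C hC => by
    obtain ⟨C', hC', hlt⟩ := exists_lt_of_csInf_lt hω.bound (hA.trans_lt hC)
    exact ⟨hC'.1.trans hlt.le, fun x r hr =>
      (hC'.2 x r hr).trans (ENNReal.ofReal_le_ofReal hlt.le)⟩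
  refine ⟨(le_csInf hω.bound fun C hC => hC.1).trans hA, fun x r hr => ?_⟩
  refine ge_of_tendsto (x := nhdsWithin A (Set.Ioi A))
    (ENNReal.continuous_ofReal.continuousWithinAt.tendsto) ?_
  filter_upwards [self_mem_nhdsWithin] with C hC
  exact (key C hC).2 x r hr

/-- An `A_q` weight that is not almost everywhere zero is almost everywhere positive. -/
theorem ae_ofReal_ne_zero {q : ℝ} (hq : 1 < q) {ω : EuclideanSpace ℝ (Fin d) → ℝ} {A : ℝ}
    (hm : AEMeasurable fun x => ENNReal.ofReal (ω x)) (hω : ApBound q ω A)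
    (h0 : ¬ (fun x => ENNReal.ofReal (ω x)) =ᵐ[volume] 0) : ∀ᵐ x, ENNReal.ofReal (ω x) ≠ 0 := by
  have hq1 : 0 < q - 1 := sub_pos.2 hq
  have hall : ∀ P : EuclideanSpace ℝ (Fin d) → Prop, ∀ N : ℕ,
      (∀ n : ℕ, N ≤ n → ∀ᵐ x ∂(volume.restrict (ball (0 : EuclideanSpace ℝ (Fin d)) n)), P x) →
      ∀ᵐ x, P x := by
    intro P N h
    have h' : ∀ᵐ x, ∀ n : ℕ, N ≤ n → x ∈ ball (0 : EuclideanSpace ℝ (Fin d)) n → P x := by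
      rw [ae_all_iff]
      intro n
      by_cases hn : N ≤ n
      · filter_upwards [(ae_restrict_iff' measurableSet_ball).1 (h n hn)] with x hx _ using hx
      · exact Filter.Eventually.of_forall fun x h => absurd h hn
    filter_upwards [h'] with x hx
    obtain ⟨n, hn⟩ := exists_nat_gt (max (N : ℝ) ‖x‖)
    refine hx n ?_ ?_
    · exact_mod_cast ((le_max_left _ _).trans_lt hn).le
    · simpa using (le_max_right _ _).trans_lt hn
  -- On a ball where `ω` has no mass, `0 * ∞ = 0` makes the `A_q` bound say nothing. On large balls
  -- with positive mass it forces a finite dual integral, hence `ω > 0` almost everywhere.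
  obtain ⟨N, hN⟩ : ∃ N : ℕ, ∫⁻ x in ball (0 : EuclideanSpace ℝ (Fin d)) N,
      ENNReal.ofReal (ω x) ≠ 0 := by
    by_contra! hcon
    refine h0 (hall _ 0 fun n _ => ?_)
    exact (lintegral_eq_zero_iff' hm.restrict).1 (hcon n)
  refine hall _ (N + 1) fun n hn => ?_
  have hn0 : (0 : ℝ) < n := by exact_mod_cast (by omega : 0 < n)
  have hb := hω.2 0 n hn0
  have hvt := volume_ball_ne_top (0 : EuclideanSpace ℝ (Fin d)) n
  have hσ : ∫⁻ x in ball (0 : EuclideanSpace ℝ (Fin d)) n,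
      ENNReal.ofReal (ω x) ^ (-(1 / (q - 1))) ≠ ∞ := by
    intro htop
    rw [setLAverage_eq, setLAverage_eq, htop, ENNReal.top_div_of_ne_top hvt,
      ENNReal.top_rpow_of_pos hq1, ENNReal.mul_top] at hb
    · exact ENNReal.ofReal_ne_top (top_le_iff.1 hb)
    · refine ENNReal.div_ne_zero.2 ⟨?_, hvt⟩
      refine (pos_iff_ne_zero.1 ((pos_iff_ne_zero.2 hN).trans_le (lintegral_mono_set ?_)))
      exact ball_subset_ball (by exact_mod_cast (by omega : N ≤ n))
  filter_upwards [ae_lt_top' (hm.restrict.pow_const _) hσ] with x hx hx0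
  rw [hx0, ENNReal.zero_rpow_of_neg (by simpa using hq1)] at hx
  exact lt_irrefl _ hx

/-- Only integrals of `ω` matter, so its measurable representative may be replaced by 1 on the null
set where it is 0 or `∞`; later divisions by the weight then need no exceptional set. -/
theorem exists_isMuckenhoupt_ae_eq {q : ℝ} (hq : 1 < q) {ω : EuclideanSpace ℝ (Fin d) → ℝ} {A : ℝ}
    (hm : AEMeasurable fun x => ENNReal.ofReal (ω x)) (hω : ApBound q ω A)
    (h0 : ¬ (fun x => ENNReal.ofReal (ω x)) =ᵐ[volume] 0) :
    ∃ w : EuclideanSpace ℝ (Fin d) → ℝ≥0∞, IsMuckenhoupt q (ENNReal.ofReal A) w ∧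
      (fun x => ENNReal.ofReal (ω x)) =ᵐ[volume] w := by
  classical
  have hq1 : 0 < q - 1 := sub_pos.2 hq
  let N : Set (EuclideanSpace ℝ (Fin d)) := {x | hm.mk _ x ≠ 0 ∧ hm.mk _ x ≠ ∞}
  have hN : MeasurableSet N :=
    (hm.measurable_mk (measurableSet_singleton 0).compl).inter
      (hm.measurable_mk (measurableSet_singleton ∞).compl)
  let w : EuclideanSpace ℝ (Fin d) → ℝ≥0∞ := N.piecewise (hm.mk _) 1
  have hw : Measurable w := Measurable.piecewise hN hm.measurable_mk measurable_one
  have hae : (fun x => ENNReal.ofReal (ω x)) =ᵐ[volume] w := by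
    filter_upwards [hm.ae_eq_mk, ae_ofReal_ne_zero hq hm hω h0] with x hx hx0
    have hxN : x ∈ N := by
      refine ⟨?_, ?_⟩ <;> rw [← hx]
      · exact hx0
      · exact ENNReal.ofReal_ne_top
    simp only [w, Set.piecewise_eq_of_mem _ _ _ hxN]
    exact hx
  refine ⟨w, ⟨hq, ENNReal.ofReal_ne_top, hw, fun x => ?_, fun x => ?_, fun x r hr => ?_⟩, hae⟩
  · by_cases hx : x ∈ N
    · simpa only [w, Set.piecewise_eq_of_mem _ _ _ hx] using hx.1
    · simp only [w, Set.piecewise_eq_of_notMem _ _ _ hx]; simp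
  · by_cases hx : x ∈ N
    · simpa only [w, Set.piecewise_eq_of_mem _ _ _ hx] using hx.2
    · simp only [w, Set.piecewise_eq_of_notMem _ _ _ hx]; simp
  · have hb := hω.2 x r hr
    have e1 : ∫⁻ y in ball x r, ENNReal.ofReal (ω y) = ∫⁻ y in ball x r, w y :=
      lintegral_congr_ae (ae_restrict_of_ae hae)
    have e2 : ∫⁻ y in ball x r, ENNReal.ofReal (ω y) ^ (-(1 / (q - 1))) =
        ∫⁻ y in ball x r, dualWeight q w y := by
      refine lintegral_congr_ae (ae_restrict_of_ae ?_)
      filter_upwards [hae] with y hy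
      rw [hy, dualWeight]
    set v := volume (ball x r) with hv
    have hv0 : v ≠ 0 := volume_ball_ne_zero x hr
    have hvt : v ≠ ∞ := volume_ball_ne_top x r
    rw [setLAverage_eq, setLAverage_eq, e1, e2, ← hv] at hb
    set W := ∫⁻ y in ball x r, w y
    set S := ∫⁻ y in ball x r, dualWeight q w y
    calc W * S ^ (q - 1) = (W / v * v) * (S / v * v) ^ (q - 1) := by
          rw [ENNReal.div_mul_cancel hv0 hvt, ENNReal.div_mul_cancel hv0 hvt]
      _ = W / v * (S / v) ^ (q - 1) * (v ^ (1 : ℝ) * v ^ (q - 1)) := by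
          rw [ENNReal.mul_rpow_of_nonneg _ _ hq1.le, ENNReal.rpow_one]; ring
      _ ≤ ENNReal.ofReal A * v ^ q := by
          rw [← ENNReal.rpow_add _ _ hv0 hvt, add_sub_cancel]
          exact mul_le_mul_left hb _

/-- The functions `G` and `H` are `2 ^ p₀` times the `p₀`-th powers of `|FB|` and `|RB|`. The
condition `γ ≤ 1` keeps `N₁` and `γ` out of the constant for `H`. -/
theorem locallyApproximable_of_exists {p₀ p₁ c₁ N₁ N₂ η : ℝ} (hd : 1 ≤ d) (hp₀ : 0 < p₀)
    (hp₁ : 0 < p₁) (hc₁ : 0 < c₁) {γ β : ℝ≥0∞} (hγ : γ ≤ 1) (hβ : ENNReal.ofReal N₁ * γ ^ (1 / p₀) +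
      ENNReal.ofReal η ≤ β)
    {ω : EuclideanSpace ℝ (Fin d) → ℝ} {w : EuclideanSpace ℝ (Fin d) → ℝ≥0∞}
    (hωw : (fun x => ENNReal.ofReal (ω x)) =ᵐ[volume] w) {x₀ : EuclideanSpace ℝ (Fin d)} {r₀ : ℝ}
    (hr₀ : 0 < r₀) {F f : EuclideanSpace ℝ (Fin d) → ℝ} {g h : EuclideanSpace ℝ (Fin d) → ℝ≥0∞}
    (hg : g =ᵐ[volume] (ball x₀ (4 * r₀)).indicator fun x => ‖F x‖ₑ ^ p₀)
    (hh : h =ᵐ[volume] (ball x₀ (4 * r₀)).indicator fun x => ‖f x‖ₑ ^ p₀)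
    (hyp : ∀ (y : EuclideanSpace ℝ (Fin d)) (r : ℝ), 0 < r →
        ball y r ⊆ ball x₀ (2 * r₀) →
        volume (ball y r) ≤ ENNReal.ofReal c₁ * volume (ball x₀ r₀) →
        ball y (100 * r) ⊆ ball x₀ (4 * r₀) →
        ∃ FB RB : EuclideanSpace ℝ (Fin d) → ℝ,
          AEStronglyMeasurable FB (volume.restrict (ball y (2 * r))) ∧
          AEStronglyMeasurable RB (volume.restrict (ball y (2 * r))) ∧
          (∀ᵐ x ∂(volume.restrict (ball y (2 * r))), |F x| ≤ |FB x| + |RB x|) ∧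
          avgPow p₀ FB (ball y (2 * r)) ≤
            ENNReal.ofReal N₁ * supAvgPow p₀ f (ball y r) (ball x₀ (4 * r₀)) +
              ENNReal.ofReal η * avgPow p₀ F (ball y (100 * r)) ∧
          avgPowWeighted p₁ ω RB (ball y (2 * r)) ≤
            ENNReal.ofReal N₂ *
              (avgPow p₀ F (ball y (100 * r)) +
                supAvgPow p₀ f (ball y r) (ball x₀ (4 * r₀))) *
              avgWeight ω (ball y r) ^ (1 / p₁)) :
    LocallyApproximable w g h x₀ r₀ (min c₁ (3 / 100)) (p₁ / p₀) γ
      (2 ^ p₀ * (ENNReal.ofReal (2 ^ d) * β ^ p₀))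
      ((2 ^ p₀) ^ (p₁ / p₀) * (ENNReal.ofReal (2 ^ d) * (ENNReal.ofReal N₂ * 2) ^ p₁)) := by
  intro y r hr hrκ hy t ht0 htt hgt hht
  -- The entry `3 / 100` gives `100 * r ≤ 3 * r₀`, so the hundredfold ball stays in the large one;
  -- the entry `c₁` gives the volume condition, since `κ ^ d ≤ κ ≤ c₁` for the minimum `κ`.
  have hκ0 : 0 < min c₁ (3 / 100) := lt_min hc₁ (by norm_num)
  have hκ1 : min c₁ (3 / 100) ≤ 1 := (min_le_right _ _).trans (by norm_num)
  have hκ3 : min c₁ (3 / 100) * r₀ ≤ 3 / 100 * r₀ := by gcongr; exact min_le_right _ _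
  rw [mem_ball] at hy
  have h100 : ball y (100 * r) ⊆ ball x₀ (4 * r₀) := ball_subset_ball' (by linarith)
  have h2sub : ball y (2 * r) ⊆ ball x₀ (4 * r₀) :=
    (ball_subset_ball (by linarith)).trans h100
  obtain ⟨FB, RB, hFBm, hRBm, hFR, hFB, hRB⟩ := hyp y r hr (ball_subset_ball' (by linarith)) (by
    calc volume (ball y r) ≤ volume (ball y (min c₁ (3 / 100) * r₀)) :=
          measure_mono (ball_subset_ball hrκ)
      _ = ENNReal.ofReal (min c₁ (3 / 100) ^ d) * volume (ball x₀ r₀) := volume_ball_mul _ _ hκ0 _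
      _ ≤ _ := by
          gcongr
          exact (pow_le_of_le_one hκ0.le hκ1 (by omega)).trans (min_le_left _ _)) h100
  have hU : avgPow p₀ F (ball y (100 * r)) ≤ t ^ (1 / p₀) := by
    rw [one_div, ENNReal.le_rpow_inv_iff hp₀, avgPow_rpow hp₀,
      ← setLIntegral_eq_of_ae_eq_indicator measurableSet_ball h100 hg]
    exact ENNReal.div_le_of_le_mul hgt
  have hS : supAvgPow p₀ f (ball y r) (ball x₀ (4 * r₀)) ≤ γ ^ (1 / p₀) * t ^ (1 / p₀) := by
    rw [← ENNReal.mul_rpow_of_nonneg _ _ (by positivity)]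
    refine iSup_le fun z => iSup_le fun s => iSup_le fun h1 => iSup_le fun h2 => ?_
    rw [one_div, ENNReal.le_rpow_inv_iff hp₀, avgPow_rpow hp₀,
      ← setLIntegral_eq_of_ae_eq_indicator measurableSet_ball h2 hh]
    exact ENNReal.div_le_of_le_mul (hht z s h1 h2)
  have hmG : AEMeasurable (fun x => 2 ^ p₀ * ‖FB x‖ₑ ^ p₀) (volume.restrict (ball y (2 * r))) :=
    (hFBm.enorm.pow_const _).const_mul _
  have hmH : AEMeasurable (fun x => 2 ^ p₀ * ‖RB x‖ₑ ^ p₀) (volume.restrict (ball y (2 * r))) :=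
    (hRBm.enorm.pow_const _).const_mul _
  obtain ⟨G, hG, hGe⟩ := exists_measurable_ae_eq_indicator measurableSet_ball hmG
  obtain ⟨H, hH, hHe⟩ := exists_measurable_ae_eq_indicator measurableSet_ball hmH
  have hv0 := volume_ball_ne_zero y (r := 2 * r) (by positivity)
  have hvt := volume_ball_ne_top y (2 * r)
  have hp2t : (2 : ℝ≥0∞) ^ p₀ ≠ ∞ := ENNReal.rpow_ne_top_of_nonneg hp₀.le (by simp)
  have htp : (t ^ (1 / p₀)) ^ p₀ = t := by
    rw [← ENNReal.rpow_mul, one_div_mul_cancel hp₀.ne', ENNReal.rpow_one]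
  refine ⟨G, H, hG, hH, ?_, ?_, ?_⟩
  · filter_upwards [hFR, ae_restrict_of_ae hg, ae_restrict_of_ae hGe, ae_restrict_of_ae hHe,
      ae_restrict_mem measurableSet_ball] with x hx hgx hGx hHx hxb
    rw [hgx, hGx, hHx, Set.indicator_of_mem hxb, Set.indicator_of_mem hxb,
      Set.indicator_of_mem (h2sub hxb), ← mul_add]
    refine le_trans ?_ (ENNReal.add_rpow_le_two_rpow_mul _ _ hp₀.le)
    gcongr
    simp only [Real.enorm_eq_ofReal_abs]
    rw [← ENNReal.ofReal_add (abs_nonneg _) (abs_nonneg _)]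
    exact ENNReal.ofReal_le_ofReal hx
  · have h1 : avgPow p₀ FB (ball y (2 * r)) ≤ β * t ^ (1 / p₀) := by
      calc _ ≤ ENNReal.ofReal N₁ * (γ ^ (1 / p₀) * t ^ (1 / p₀)) +
            ENNReal.ofReal η * t ^ (1 / p₀) := hFB.trans (by gcongr)
        _ = (ENNReal.ofReal N₁ * γ ^ (1 / p₀) + ENNReal.ofReal η) * t ^ (1 / p₀) := by ring
        _ ≤ _ := by gcongr
    have h2 := ENNReal.rpow_le_rpow h1 hp₀.le
    rw [avgPow_rpow hp₀, ENNReal.mul_rpow_of_nonneg _ _ hp₀.le, htp,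
      ENNReal.div_le_iff hv0 hvt, volume_ball_mul y y two_pos] at h2
    rw [setLIntegral_eq_of_ae_eq_indicator measurableSet_ball subset_rfl hGe,
      lintegral_const_mul' _ _ hp2t]
    refine (mul_le_mul_right h2 _).trans (le_of_eq ?_)
    ring
  · have h1 : avgPowWeighted p₁ ω RB (ball y (2 * r)) ≤
        ENNReal.ofReal N₂ * 2 * t ^ (1 / p₀) * avgWeight ω (ball y r) ^ (1 / p₁) := by
      calc _ ≤ ENNReal.ofReal N₂ * (t ^ (1 / p₀) + 1 * t ^ (1 / p₀)) *
            avgWeight ω (ball y r) ^ (1 / p₁) := by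
            refine hRB.trans ?_
            gcongr
            refine hS.trans ?_
            gcongr
            exact ENNReal.rpow_le_one hγ (by positivity)
        _ = _ := by rw [one_mul, ← two_mul]; ring
    have h2 := ENNReal.rpow_le_rpow h1 hp₁.le
    have hW : avgWeight ω (ball y r) = volume.withDensity w (ball y r) / volume (ball y r) := by
      rw [avgWeight, setLAverage_eq, withDensity_apply _ measurableSet_ball,
        lintegral_congr_ae (ae_restrict_of_ae hωw)]
    have hRw : ∫⁻ x in ball y (2 * r), ‖RB x‖ₑ ^ p₁ * ENNReal.ofReal (ω x) =
        ∫⁻ x in ball y (2 * r), ‖RB x‖ₑ ^ p₁ * w x := by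
      refine lintegral_congr_ae (ae_restrict_of_ae ?_)
      filter_upwards [hωw] with x hx
      rw [hx]
    rw [avgPowWeighted_rpow hp₁, ENNReal.mul_rpow_of_nonneg _ _ hp₁.le,
      ENNReal.mul_rpow_of_nonneg _ _ hp₁.le, ← ENNReal.rpow_mul, ← ENNReal.rpow_mul,
      one_div_mul_cancel hp₁.ne', ENNReal.rpow_one, one_div_mul_eq_div, hW, hRw,
      ENNReal.div_le_iff hv0 hvt, volume_ball_mul y y two_pos] at h2
    rw [setLIntegral_rpow_mul_eq_of_ae_eq_indicator measurableSet_ball subset_rfl hHe]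
    have e : ∀ x, (2 ^ p₀ * ‖RB x‖ₑ ^ p₀) ^ (p₁ / p₀) * w x =
        (2 ^ p₀) ^ (p₁ / p₀) * (‖RB x‖ₑ ^ p₁ * w x) := by
      intro x
      rw [ENNReal.mul_rpow_of_nonneg _ _ (by positivity), ← ENNReal.rpow_mul ‖RB x‖ₑ,
        mul_div_cancel₀ _ hp₀.ne', mul_assoc]
    simp_rw [e]
    rw [lintegral_const_mul' _ _ (ENNReal.rpow_ne_top_of_nonneg (by positivity) hp2t)]
    refine (mul_le_mul_right h2 _).trans (le_of_eq ?_)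
    have hc := ENNReal.div_mul_cancel (b := volume.withDensity w (ball y r))
      (volume_ball_ne_zero y hr) (volume_ball_ne_top y r)
    conv_rhs => rw [← hc]
    ring

end Translation

/-! ### The main theorem. -/

theorem theorem2p1 (d : ℕ) (hd : 1 ≤ d) (p₀ p p₁ : ℝ) (hp₀ : 0 < p₀) (hp : p₀ < p) (hp₁ : p < p₁)
    (c₁ : ℝ) (hc₁ : 0 < c₁) (hc₁' : c₁ < 1) (N₂ : ℝ) (hN₂ : 1 < N₂) (A : ℝ) :
    ∃ η₀ : ℝ, 0 < η₀ ∧ ∀ N₁ : ℝ, 1 < N₁ → ∃ C : ℝ, 0 < C ∧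
      ∀ ω : EuclideanSpace ℝ (Fin d) → ℝ, IsApWeight (p / p₀) ω → apConstant (p / p₀) ω ≤ A →
      ∀ (x₀ : EuclideanSpace ℝ (Fin d)) (r₀ : ℝ), 0 < r₀ →
      ∀ F f : EuclideanSpace ℝ (Fin d) → ℝ,
      MemLp F (ENNReal.ofReal p) (volume.restrict (ball x₀ (4 * r₀))) →
      MemLp f (ENNReal.ofReal p) (volume.restrict (ball x₀ (4 * r₀))) →
      ∀ η : ℝ, 0 ≤ η → η ≤ η₀ →
      (∀ (y : EuclideanSpace ℝ (Fin d)) (r : ℝ), 0 < r →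
        ball y r ⊆ ball x₀ (2 * r₀) →
        volume (ball y r) ≤ ENNReal.ofReal c₁ * volume (ball x₀ r₀) →
        ball y (100 * r) ⊆ ball x₀ (4 * r₀) →
        ∃ FB RB : EuclideanSpace ℝ (Fin d) → ℝ,
          AEStronglyMeasurable FB (volume.restrict (ball y (2 * r))) ∧
          AEStronglyMeasurable RB (volume.restrict (ball y (2 * r))) ∧
          (∀ᵐ x ∂(volume.restrict (ball y (2 * r))), |F x| ≤ |FB x| + |RB x|) ∧
          avgPow p₀ FB (ball y (2 * r)) ≤
            ENNReal.ofReal N₁ * supAvgPow p₀ f (ball y r) (ball x₀ (4 * r₀)) +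
              ENNReal.ofReal η * avgPow p₀ F (ball y (100 * r)) ∧
          avgPowWeighted p₁ ω RB (ball y (2 * r)) ≤
            ENNReal.ofReal N₂ *
              (avgPow p₀ F (ball y (100 * r)) +
                supAvgPow p₀ f (ball y r) (ball x₀ (4 * r₀))) *
              avgWeight ω (ball y r) ^ (1 / p₁)) →
      avgPowWeighted p ω F (ball x₀ r₀) ≤
        ENNReal.ofReal C * avgPowWeighted p ω f (ball x₀ (4 * r₀)) +
          ENNReal.ofReal C * avgPow p₀ F (ball x₀ (4 * r₀)) *
            avgWeight ω (ball x₀ r₀) ^ (1 / p) := by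
  have hp0 : 0 < p := hp₀.trans hp
  have hp10 : 0 < p₁ := hp0.trans hp₁
  have hq : 1 < p / p₀ := (one_lt_div hp₀).2 hp
  have hqs : p / p₀ < p₁ / p₀ := by gcongr
  have hκ0 : 0 < min c₁ (3 / 100) := lt_min hc₁ (by norm_num)
  have hκ1 : min c₁ (3 / 100) ≤ 1 := (min_le_right _ _).trans (by norm_num)
  have h2t : (2 : ℝ≥0∞) ^ p₀ ≠ ∞ := ENNReal.rpow_ne_top_of_nonneg hp₀.le (by simp)
  have h20 : (2 : ℝ≥0∞) ^ p₀ ≠ 0 := rpow_ne_zero_of_nonneg (by simp) hp₀.le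
  have hK : ((2 : ℝ≥0∞) ^ p₀) ^ (p₁ / p₀) *
      (ENNReal.ofReal (2 ^ d) * (ENNReal.ofReal N₂ * 2) ^ p₁) ≠ ∞ :=
    ENNReal.mul_ne_top (ENNReal.rpow_ne_top_of_nonneg (by positivity) h2t)
      (ENNReal.mul_ne_top ENNReal.ofReal_ne_top (ENNReal.rpow_ne_top_of_nonneg hp10.le
        (ENNReal.mul_ne_top ENNReal.ofReal_ne_top (by simp))))
  obtain ⟨ε, hε, hmain⟩ := exists_lintegral_rpow_le_of_locallyApproximable hd hq hqs hκ0 hκ1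
    (A := ENNReal.ofReal A) ENNReal.ofReal_ne_top hK
  obtain ⟨β, hβ0, hβ⟩ : ∃ β : ℝ, 0 < β ∧
      2 ^ p₀ * (ENNReal.ofReal (2 ^ d) * ENNReal.ofReal β ^ p₀) ≤ ε := by
    have hk0 : (2 : ℝ≥0∞) ^ p₀ * ENNReal.ofReal (2 ^ d) ≠ 0 := mul_ne_zero h20 (by simp)
    have hkt : (2 : ℝ≥0∞) ^ p₀ * ENNReal.ofReal (2 ^ d) ≠ ∞ :=
      ENNReal.mul_ne_top h2t ENNReal.ofReal_ne_top
    -- The minimum with 1 guards against `ε = ∞`.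
    set b := min 1 ((ε / (2 ^ p₀ * ENNReal.ofReal (2 ^ d))) ^ (1 / p₀)) with hb
    have hb0 : b ≠ 0 := (lt_min one_pos (pos_iff_ne_zero.2 (rpow_ne_zero_of_nonneg
      (ENNReal.div_ne_zero.2 ⟨hε, hkt⟩) (by positivity)))).ne'
    have hbt : b ≠ ∞ := ((min_le_left _ _).trans_lt ENNReal.one_lt_top).ne
    refine ⟨b.toReal, ENNReal.toReal_pos hb0 hbt, ?_⟩
    have h1 : b ≤ (ε / (2 ^ p₀ * ENNReal.ofReal (2 ^ d))) ^ (1 / p₀) := min_le_right _ _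
    rw [one_div, ENNReal.le_rpow_inv_iff hp₀, ENNReal.le_div_iff_mul_le (Or.inl hk0) (Or.inl hkt)]
      at h1
    rw [ENNReal.ofReal_toReal hbt]
    refine le_trans (le_of_eq ?_) h1
    ring
  -- Half of `β` is left for `η`; the other half absorbs `N₁ * γ ^ (1 / p₀)` once `N₁` is known.
  refine ⟨β / 2, by positivity, fun N₁ hN₁ => ?_⟩
  obtain ⟨γ, hγ0, hγ1, hγ⟩ : ∃ γ : ℝ≥0∞, γ ≠ 0 ∧ γ ≤ 1 ∧
      ENNReal.ofReal N₁ * γ ^ (1 / p₀) ≤ ENNReal.ofReal (β / 2) := by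
    refine ⟨min 1 (ENNReal.ofReal (β / (2 * N₁)) ^ p₀), ?_, min_le_left _ _, ?_⟩
    · refine (lt_min one_pos (pos_iff_ne_zero.2 (rpow_ne_zero_of_nonneg ?_ hp₀.le))).ne'
      simp only [ne_eq, ENNReal.ofReal_eq_zero, not_le]
      positivity
    · calc _ ≤ ENNReal.ofReal N₁ * (ENNReal.ofReal (β / (2 * N₁)) ^ p₀) ^ (1 / p₀) := by
            gcongr; exact min_le_right _ _
        _ = ENNReal.ofReal N₁ * ENNReal.ofReal (β / (2 * N₁)) := by
            rw [← ENNReal.rpow_mul, mul_one_div_cancel hp₀.ne', ENNReal.rpow_one]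
        _ = ENNReal.ofReal (β / 2) := by
            rw [← ENNReal.ofReal_mul (by linarith)]
            congr 1; field_simp
        _ ≤ _ := le_rfl
  obtain ⟨C, hCt, hC⟩ := hmain γ hγ0 (ne_top_of_le_ne_top ENNReal.one_ne_top hγ1)
  set k := ENNReal.ofReal (4 ^ d) with hk
  set C' := 2 * (C * k + C * k ^ (p / p₀)) with hC'
  have hC't : C' ^ (1 / p) ≠ ∞ := ENNReal.rpow_ne_top_of_nonneg (by positivity)
    (ENNReal.mul_ne_top (by simp) (ENNReal.add_ne_top.2 ⟨ENNReal.mul_ne_top hCt (by simp [hk]),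
      ENNReal.mul_ne_top hCt (ENNReal.rpow_ne_top_of_nonneg (by positivity) (by simp [hk]))⟩))
  refine ⟨(C' ^ (1 / p)).toReal + 1, by positivity, ?_⟩
  intro ω hω hωA x₀ r₀ hr₀ F f hF hf η hη0 hη hyp
  have hCC : C' ^ (1 / p) ≤ ENNReal.ofReal ((C' ^ (1 / p)).toReal + 1) :=
    ENNReal.le_ofReal_iff_toReal_le hC't (by positivity) |>.2 (by linarith)
  have hmω : AEMeasurable fun x => ENNReal.ofReal (ω x) :=
    ENNReal.measurable_ofReal.comp_aemeasurable
      hω.locallyIntegrable.aestronglyMeasurable.aemeasurable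
  -- The zero weight satisfies `IsApWeight` but has no positive representative; its left side is 0.
  by_cases h0 : (fun x => ENNReal.ofReal (ω x)) =ᵐ[volume] 0
  · have : avgPowWeighted p ω F (ball x₀ r₀) = 0 := by
      rw [avgPowWeighted, setLAverage_eq]
      have : ∫⁻ x in ball x₀ r₀, ‖F x‖ₑ ^ p * ENNReal.ofReal (ω x) = 0 := by
        rw [← lintegral_zero (μ := volume.restrict (ball x₀ r₀))]
        refine lintegral_congr_ae (ae_restrict_of_ae ?_)
        filter_upwards [h0] with x hx
        rw [hx]; simp
      rw [this, ENNReal.zero_div, ENNReal.zero_rpow_of_pos (by positivity)]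
    rw [this]; exact zero_le
  obtain ⟨w, hw, hωw⟩ := exists_isMuckenhoupt_ae_eq hq hmω (apBound_of_apConstant_le hω hωA) h0
  obtain ⟨g, hgm, hg⟩ := exists_measurable_ae_eq_indicator
    (measurableSet_ball (x := x₀) (ε := 4 * r₀)) (hF.aestronglyMeasurable.enorm.pow_const p₀)
  obtain ⟨h, hhm, hh⟩ := exists_measurable_ae_eq_indicator
    (measurableSet_ball (x := x₀) (ε := 4 * r₀)) (hf.aestronglyMeasurable.enorm.pow_const p₀)
  set B := ball x₀ r₀ with hB
  set B4 := ball x₀ (4 * r₀) with hB4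
  have hv0 : volume B ≠ 0 := volume_ball_ne_zero x₀ hr₀
  have hvt : volume B ≠ ∞ := volume_ball_ne_top x₀ r₀
  have hk0 : k ≠ 0 := by simp [hk]
  have hkt : k ≠ ∞ := ENNReal.ofReal_ne_top
  have hv4 : volume B4 = k * volume B := volume_ball_mul x₀ x₀ (by norm_num) r₀
  have hBB : B ⊆ B4 := ball_subset_ball (by linarith)
  have hgi : ∫⁻ x, g x = ∫⁻ x in B4, ‖F x‖ₑ ^ p₀ := by
    rw [lintegral_congr_ae hg, lintegral_indicator measurableSet_ball]
  have hgfin : ∫⁻ x, g x ≠ ∞ := by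
    have : IsFiniteMeasure (volume.restrict B4) :=
      ⟨by simpa using (volume_ball_ne_top x₀ (4 * r₀)).lt_top⟩
    -- On a ball of finite measure `L^p` lies in `L^{p₀}`, which makes `g` integrable.
    have h1 := hF.mono_exponent (ENNReal.ofReal_le_ofReal hp.le)
    have h2 := lintegral_rpow_enorm_lt_top_of_eLpNorm_lt_top (by simpa using hp₀)
      ENNReal.ofReal_ne_top h1.eLpNorm_lt_top
    rw [ENNReal.toReal_ofReal hp₀.le] at h2
    rw [hgi]; exact h2.ne
  have happ : LocallyApproximable w g h x₀ r₀ (min c₁ (3 / 100)) (p₁ / p₀) γ ε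
      ((2 ^ p₀) ^ (p₁ / p₀) * (ENNReal.ofReal (2 ^ d) * (ENNReal.ofReal N₂ * 2) ^ p₁)) := by
    have h1 := locallyApproximable_of_exists hd hp₀ hp10 hc₁ hγ1 (β := ENNReal.ofReal β) (by
      calc _ ≤ ENNReal.ofReal (β / 2) + ENNReal.ofReal (β / 2) := by gcongr
        _ = _ := by rw [← ENNReal.ofReal_add (by positivity) (by positivity), add_halves])
      hωw hr₀ hg hh hyp
    intro y r hr hrκ hy t ht0 htt hgt hht
    obtain ⟨G, H, hG, hH, h2, h3, h4⟩ := h1 y r hr hrκ hy t ht0 htt hgt hht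
    exact ⟨G, H, hG, hH, h2, h3.trans (by gcongr), h4⟩
  have key := hC w g h x₀ r₀ hr₀ hw hgm hhm hgfin happ
  have hpow : ∀ a : ℝ≥0∞, (a ^ p₀) ^ (p / p₀) = a ^ p := fun a => by
    rw [← ENNReal.rpow_mul, mul_div_cancel₀ _ hp₀.ne']
  have e1 : ∫⁻ x in B, g x ^ (p / p₀) * w x = avgPowWeighted p ω F B ^ p * volume B := by
    rw [avgPowWeighted_rpow hp0, ENNReal.div_mul_cancel hv0 hvt,
      setLIntegral_rpow_mul_eq_of_ae_eq_indicator measurableSet_ball hBB hg]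
    refine lintegral_congr_ae (ae_restrict_of_ae ?_)
    filter_upwards [hωw] with x hx
    rw [hpow, hx]
  have e2 : ∫⁻ x, h x ^ (p / p₀) * w x = avgPowWeighted p ω f B4 ^ p * (k * volume B) := by
    rw [avgPowWeighted_rpow hp0, ← hv4, ENNReal.div_mul_cancel
      (volume_ball_ne_zero x₀ (by positivity)) (volume_ball_ne_top x₀ (4 * r₀)),
      ← lintegral_indicator measurableSet_ball]
    refine lintegral_congr_ae ?_
    filter_upwards [hωw, hh] with x hx hhx
    rw [hhx]
    by_cases hxB : x ∈ B4
    · rw [Set.indicator_of_mem hxB, Set.indicator_of_mem hxB, hpow, hx]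
    · rw [Set.indicator_of_notMem hxB, Set.indicator_of_notMem hxB,
        ENNReal.zero_rpow_of_pos (by positivity), zero_mul]
  have e3 : ((∫⁻ x, g x) / volume B) ^ (p / p₀) = k ^ (p / p₀) * avgPow p₀ F B4 ^ p := by
    rw [← hpow, ← ENNReal.mul_rpow_of_nonneg _ _ (by positivity), avgPow_rpow hp₀, hv4, hgi]
    congr 1
    rw [div_eq_mul_inv, div_eq_mul_inv, ENNReal.mul_inv (Or.inl hk0) (Or.inl hkt),
      mul_left_comm, ← mul_assoc k, ENNReal.mul_inv_cancel hk0 hkt, one_mul]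
  have e4 : ∫⁻ x in B, w x = (avgWeight ω B ^ (1 / p)) ^ p * volume B := by
    rw [← ENNReal.rpow_mul, one_div_mul_cancel hp0.ne', ENNReal.rpow_one, avgWeight, setLAverage_eq,
      ENNReal.div_mul_cancel hv0 hvt, lintegral_congr_ae (ae_restrict_of_ae hωw)]
  rw [e1, e2, e3, e4] at key
  set a := avgPowWeighted p ω f B4
  set b := avgPow p₀ F B4
  set m := avgWeight ω B ^ (1 / p)
  have key2 : avgPowWeighted p ω F B ^ p ≤ C' * (a + b * m) ^ p := by
    refine (ENNReal.mul_le_mul_iff_left hv0 hvt).1 (key.trans ?_)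
    have ha : a ^ p ≤ (a + b * m) ^ p := ENNReal.rpow_le_rpow le_self_add hp0.le
    have hb : b ^ p * m ^ p ≤ (a + b * m) ^ p := by
      rw [← ENNReal.mul_rpow_of_nonneg _ _ hp0.le]
      exact ENNReal.rpow_le_rpow le_add_self hp0.le
    calc _ = C * k * a ^ p * volume B + C * k ^ (p / p₀) * (b ^ p * m ^ p) * volume B := by ring
      _ ≤ C * k * (a + b * m) ^ p * volume B + C * k ^ (p / p₀) * (a + b * m) ^ p * volume B := by
          gcongr
      _ = (C * k + C * k ^ (p / p₀)) * (a + b * m) ^ p * volume B := by ring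
      _ ≤ _ := by
          rw [hC']
          gcongr
          exact le_mul_of_one_le_left zero_le (by norm_num)
  have key3 := ENNReal.rpow_le_rpow key2 (z := 1 / p) (by positivity)
  rw [ENNReal.mul_rpow_of_nonneg _ _ (by positivity), ← ENNReal.rpow_mul, ← ENNReal.rpow_mul,
    mul_one_div_cancel hp0.ne', ENNReal.rpow_one, ENNReal.rpow_one] at key3
  calc _ ≤ C' ^ (1 / p) * (a + b * m) := key3
    _ ≤ ENNReal.ofReal ((C' ^ (1 / p)).toReal + 1) * (a + b * m) := by gcongr
    _ = _ := by ring
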